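/- Let $k$ be a field, $S = k[x_1,\dots,x_n]$, and let $B \subseteq S$ be an ideal generated by square-free monomials. For $i \ge 0$ let $H^i_B(S) = \varinjlim_t \operatorname{Ext}^i_S(S/B^t, S)$ be the $i$-th local cohomology module of $S$ with support in $B$, with its natural $\mathbf{Z}^n$-grading: $H^i_B(S)_p$ is the set of images of the classes in $\operatorname{Ext}^i_S(S/B^t,S)$, $t \ge 0$, that are represented by cocycles of degree $p$ on $\mathbf{Z}^n$-graded projective resolutions of $S/B^t$. For $p \in \mathbf{Z}^n$ set $\operatorname{neg}(p) = \{ j \in \{1,\dots,n\} \mid p_j < 0\}$. If $p, q \in \mathbf{Z}^n$ satisfy $\operatorname{neg}(p) = \operatorname{neg}(q)$, then there is a canonical isomorphism of $k$-vector spaces $$H^i_B(S)_p \cong H^i_B(S)_q .$$ Here canonical means: for each $i$ there is exactly one family of $k$-linear isomorphisms $\varphi_{p,q} : H^i_B(S)_p \to H^i_B(S)_q$, indexed by the pairs $p,q \in \mathbf{Z}^n$ with $\operatorname{neg}(p) = \operatorname{neg}(q)$, such that $\varphi_{q,r} \circ \varphi_{p,q} = \varphi_{p,r}$ whenever $\operatorname{neg}(p)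 = \operatorname{neg}(q) = \operatorname{neg}(r)$, and such that $\varphi_{p,q}$ is multiplication by the monomial $x^{q-p}$ whenever $q - p \in \mathbf{N}^n$. -/

import Mathlib

open CategoryTheory MvPolynomial

universe u

noncomputable section

namespace MonomialLC

/-- The set of coordinates in which `p` is negative. -/
def neg {n : ℕ} (p : Fin n → ℤ) : Set (Fin n) := {j | p j < 0}

/-- An ideal generated by square-free monomials `∏_{j ∈ s} x_j` (the zero ideal and the unit
ideal are included). -/
def IsSquarefreeMonomialIdeal {k : Type u} [Field k] {n : ℕ}
    (B : Ideal (MvPolynomial (Fin n) k)) : Prop :=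
  ∃ A : Set (Finset (Fin n)),
    B = Ideal.span ((fun s : Finset (Fin n) => ∏ j ∈ s, (X j : MvPolynomial (Fin n) k)) '' A)

/-- The fine grading of `S = k[x_1, …, x_n]` by `ℤⁿ`, where `x_j` has degree the `j`-th unit
vector. The component of degree `p` is zero if `p` has a negative coordinate. -/
abbrev fineDegree (k : Type u) [Field k] {n : ℕ} (p : Fin n → ℤ) :
    Submodule k (MvPolynomial (Fin n) k) :=
  weightedHomogeneousSubmodule k (fun j : Fin n => (Pi.single j 1 : Fin n → ℤ)) p

/-- The polynomial ring as a module over itself. -/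
abbrev polyModule (k : Type u) [Field k] (n : ℕ) : ModuleCat.{u} (MvPolynomial (Fin n) k) :=
  ModuleCat.of (MvPolynomial (Fin n) k) (MvPolynomial (Fin n) k)

/-- A `ℤⁿ`-graded projective resolution of `S / I`: a projective resolution whose terms are
`ℤⁿ`-graded `S`-modules and whose differentials and augmentation preserve degrees (`S / I`
carries the grading induced from `S`). -/
structure GradedResolution {k : Type u} [Field k] {n : ℕ}
    (I : Ideal (MvPolynomial (Fin n) k)) where
  /-- the underlying projective resolution -/
  res : ProjectiveResolution
    (ModuleCat.of (MvPolynomial (Fin n) k) (MvPolynomial (Fin n) k ⧸ I))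
  /-- the homogeneous components of the terms -/
  part : ∀ j : ℕ, (Fin n → ℤ) → AddSubgroup (res.complex.X j)
  isInternal : ∀ j, DirectSum.IsInternal (part j)
  gradedSMul : ∀ j, SetLike.GradedSMul (fun a : Fin n → ℤ => fineDegree k a) (part j)
  d_mem : ∀ (j : ℕ) (a : Fin n → ℤ), ∀ x ∈ part (j + 1) a,
    (res.complex.d (j + 1) j).hom x ∈ part j a
  π_mem : ∀ (a : Fin n → ℤ), ∀ x ∈ part 0 a, ∃ f ∈ fineDegree k a,
    (res.π.f 0).hom x = Ideal.Quotient.mk I f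

/-- A homomorphism from a term of a graded resolution to `S` is homogeneous of degree `p` if it
sends the component of degree `a` into `S_{a + p}` for every `a`. -/
def GradedResolution.IsHomogeneousHom {k : Type u} [Field k] {n : ℕ}
    {I : Ideal (MvPolynomial (Fin n) k)} (P : GradedResolution I) (i : ℕ) (p : Fin n → ℤ)
    (c : P.res.complex.X i ⟶ polyModule k n) : Prop :=
  ∀ (a : Fin n → ℤ), ∀ x ∈ P.part i a, c.hom x ∈ fineDegree k (a + p)

/-- An element of `Ext^i_S(S / I, S)` is homogeneous of degree `p` if it is the class of a cocycle
of `Hom_S(P, S)` that is homogeneous of degree `p`, for a graded projective resolution `P` of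
`S / I`. -/
def IsHomogeneousExt {k : Type u} [Field k] {n : ℕ} (I : Ideal (MvPolynomial (Fin n) k))
    (i : ℕ) (p : Fin n → ℤ)
    (e : ((Ext (MvPolynomial (Fin n) k) (ModuleCat.{u} (MvPolynomial (Fin n) k)) i).obj
      (Opposite.op (ModuleCat.of (MvPolynomial (Fin n) k) (MvPolynomial (Fin n) k ⧸ I)))).obj
        (polyModule k n)) : Prop :=
  ∃ (P : GradedResolution I)
    (z : (P.res.complex.linearYonedaObj (MvPolynomial (Fin n) k) (polyModule k n)).cycles i),
    P.IsHomogeneousHom i p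
      (((P.res.complex.linearYonedaObj (MvPolynomial (Fin n) k) (polyModule k n)).iCycles i).hom
        z) ∧
    (P.res.isoExt i (polyModule k n)).inv.hom
      (((P.res.complex.linearYonedaObj (MvPolynomial (Fin n) k) (polyModule k n)).homologyπ i).hom
        z) = e

variable {k : Type u} [Field k] {n : ℕ}

/-- The local cohomology module `H^i_B(S) = colim_t Ext^i_S(S / B^t, S)`. -/
def LC (B : Ideal (MvPolynomial (Fin n) k)) (i : ℕ) : Type u :=
  (localCohomology B i).obj (polyModule k n)

instance (B : Ideal (MvPolynomial (Fin n) k)) (i : ℕ) : AddCommGroup (LC B i) :=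
  inferInstanceAs (AddCommGroup ((localCohomology B i).obj (polyModule k n)))

instance (B : Ideal (MvPolynomial (Fin n) k)) (i : ℕ) :
    Module (MvPolynomial (Fin n) k) (LC B i) :=
  inferInstanceAs (Module (MvPolynomial (Fin n) k) ((localCohomology B i).obj (polyModule k n)))

/-- The `k`-vector space structure, by restriction of scalars along `k → S`. -/
instance (B : Ideal (MvPolynomial (Fin n) k)) (i : ℕ) : Module k (LC B i) :=
  Module.compHom _ (algebraMap k (MvPolynomial (Fin n) k))

instance (B : Ideal (MvPolynomial (Fin n) k)) (i : ℕ) :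
    IsScalarTower k (MvPolynomial (Fin n) k) (LC B i) :=
  IsScalarTower.of_algebraMap_smul fun _ _ => rfl

/-- The canonical map `Ext^i_S(S / B^t, S) → H^i_B(S)` to the direct limit. -/
def toLC (B : Ideal (MvPolynomial (Fin n) k)) (i t : ℕ) :
    ((Ext (MvPolynomial (Fin n) k) (ModuleCat.{u} (MvPolynomial (Fin n) k)) i).obj
      (Opposite.op (ModuleCat.of (MvPolynomial (Fin n) k) (MvPolynomial (Fin n) k ⧸ B ^ t)))).obj
        (polyModule k n) →ₗ[MvPolynomial (Fin n) k] LC B i :=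
  ((Limits.colimit.ι (localCohomology.diagram (localCohomology.idealPowersDiagram B) i)
    (Opposite.op (Opposite.op t))).app (polyModule k n)).hom

/-- The component `H^i_B(S)_p` of degree `p` for the natural `ℤⁿ`-grading: it consists of the
images of the elements of degree `p` of the modules `Ext^i_S(S / B^t, S)`. (For a monomial ideal
`B` these images already form a `k`-subspace, so taking the span adds nothing.) -/
def degreePart (B : Ideal (MvPolynomial (Fin n) k)) (i : ℕ) (p : Fin n → ℤ) :
    Submodule k (LC B i) :=
  Submodule.span k {h | ∃ t e, IsHomogeneousExt (B ^ t) i p e ∧ toLC B i t e = h}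

end MonomialLC

end

noncomputable section

namespace MonomialLC

variable {k : Type u} [Field k] {n : ℕ}

/-! Write `e_j` for the `j`-th unit vector. Everything reduces to one step: if `p_j ≠ -1`, then
multiplication by `x_j` is a bijection from `H^i_B(S)_p` to `H^i_B(S)_{p + e_j}`. The condition says
exactly that `p` and `p + e_j` have the same negative coordinates. Monomials then follow by
composition (`monomial_smul_bijective`). Arbitrary `p, q` are joined through `p ⊔ q`, which has the
same sign pattern, and transitivity leaves no other choice.

For the step, pick `c > 0` not dividing `p_j + 1`. The powers `B^t` are cofinal with the ideals
`B^[m]` generated by the `m`-th powers of the square-free generators, and `m` may be taken to be a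
multiple of `c`. On `S / B^[m]` multiplication by `x_j` out of degree `a` can fail to be bijective
only for `a_j + 1 = 0` or `a_j + 1 = m`, hence only for `c ∣ a_j + 1`; this is the property
`IsTame`. A tame module is generated in degrees whose `j`-th coordinate is divisible by `c`, and the
kernel of the resulting free cover is tame again (`IsTame.syzygy`). So there is a graded free
resolution `F` whose basis degrees `d` all satisfy `c ∣ d_j`.

A homogeneous map `F_i → S` of degree `p + e_j` sends a basis element of degree `d` into `S_{d + p +
e_j}`. Since `d_j + p_j + 1 ≠ 0`, the value is divisible by `x_j`. Hence `x_j` is bijective from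
cochains of degree `p` to cochains of degree `p + e_j`, and the same holds on Ext
(`exists_X_smul_ext_eq`, `ext_eq_zero_of_X_smul`) and in the limit (`exists_X_smul_eq`,
`eq_zero_of_X_smul_eq_zero`). Degrees in Ext may be tested on `F`, because `F` maps to any graded
resolution by a degree-preserving chain map (`exists_gradedChainMap`). -/

/-! ### Homogeneous components of polynomials. -/

lemma weight_single_eq (d : Fin n →₀ ℕ) :
    Finsupp.weight (fun j : Fin n => (Pi.single j 1 : Fin n → ℤ)) d = fun j => (d j : ℤ) := by
  ext j
  simp [Finsupp.weight_apply, Finsupp.sum_fintype, Finset.sum_apply, Pi.single_apply]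

lemma mem_fineDegree {a : Fin n → ℤ} {f : MvPolynomial (Fin n) k} :
    f ∈ fineDegree k a ↔ ∀ d, coeff d f ≠ 0 → (fun j => (d j : ℤ)) = a := by
  rw [mem_weightedHomogeneousSubmodule]
  simp only [IsWeightedHomogeneous, weight_single_eq]

lemma monomial_mem_fineDegree (d : Fin n →₀ ℕ) (r : k) :
    monomial d r ∈ fineDegree k (fun j => (d j : ℤ)) :=
  isWeightedHomogeneous_monomial _ _ _ (weight_single_eq d)

lemma X_mem_fineDegree (j : Fin n) :
    (X j : MvPolynomial (Fin n) k) ∈ fineDegree k (Pi.single j 1 : Fin n → ℤ) :=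
  isWeightedHomogeneous_X _ _ _

lemma mul_mem_fineDegree {a b : Fin n → ℤ} {f g : MvPolynomial (Fin n) k}
    (hf : f ∈ fineDegree k a) (hg : g ∈ fineDegree k b) : f * g ∈ fineDegree k (a + b) :=
  IsWeightedHomogeneous.mul hf hg

/-- The homogeneous component of degree `a` of a polynomial. -/
abbrev fineComponent (k : Type u) [Field k] {n : ℕ} (a : Fin n → ℤ) :
    MvPolynomial (Fin n) k →ₗ[k] MvPolynomial (Fin n) k :=
  weightedHomogeneousComponent (fun j : Fin n => (Pi.single j 1 : Fin n → ℤ)) a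

lemma fineComponent_mem (a : Fin n → ℤ) (f : MvPolynomial (Fin n) k) :
    fineComponent k a f ∈ fineDegree k a :=
  weightedHomogeneousComponent_mem _ _ _

lemma fineComponent_same {a : Fin n → ℤ} {f : MvPolynomial (Fin n) k}
    (hf : f ∈ fineDegree k a) : fineComponent k a f = f :=
  IsWeightedHomogeneous.weightedHomogeneousComponent_same hf

lemma fineComponent_ne {a b : Fin n → ℤ} {f : MvPolynomial (Fin n) k}
    (hf : f ∈ fineDegree k a) (h : a ≠ b) : fineComponent k b f = 0 :=
  IsWeightedHomogeneous.weightedHomogeneousComponent_ne _ hf h.symm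

lemma fineComponent_mul {a b : Fin n → ℤ} {s : MvPolynomial (Fin n) k}
    (hs : s ∈ fineDegree k b) (f : MvPolynomial (Fin n) k) :
    fineComponent k (b + a) (s * f) = s * fineComponent k a f := by
  induction f using MvPolynomial.induction_on' with
  | monomial d r =>
    by_cases h : (fun j => (d j : ℤ)) = a
    · subst h
      rw [fineComponent_same (mul_mem_fineDegree hs (monomial_mem_fineDegree d r)),
        fineComponent_same (monomial_mem_fineDegree d r)]
    · rw [fineComponent_ne (mul_mem_fineDegree hs (monomial_mem_fineDegree d r)) (by simpa using h),
        fineComponent_ne (monomial_mem_fineDegree d r) h, mul_zero]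
  | add p q hp hq => rw [mul_add, map_add, map_add, hp, hq, mul_add]

lemma coeff_fineComponent_ne_zero {a : Fin n → ℤ} {f : MvPolynomial (Fin n) k} {d : Fin n →₀ ℕ}
    (h : coeff d (fineComponent k a f) ≠ 0) : coeff d f ≠ 0 := by
  classical
  rw [coeff_weightedHomogeneousComponent] at h
  exact fun h' => h (by simp [h'])

lemma X_mul_mem_fineDegree_iff {a : Fin n → ℤ} {j : Fin n} {g : MvPolynomial (Fin n) k} :
    X j * g ∈ fineDegree k (a + Pi.single j 1) ↔ g ∈ fineDegree k a := by
  constructor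
  · intro h
    rw [mem_fineDegree] at h ⊢
    intro d hd
    have := h (Finsupp.single j 1 + d) (by rwa [coeff_X_mul])
    funext l
    have := congrFun this l
    by_cases hl : l = j
    · subst hl; simp at this; omega
    · simp [hl] at this; simpa using this
  · intro h
    rw [add_comm]
    exact mul_mem_fineDegree (X_mem_fineDegree j) h

/-- Each monomial of `f` has exponent `a j ≠ 0` at `x_j`; for negative `a j` there are none. All
later divisions by `x_j` rest on this. -/
lemma X_mul_divMonomial_of_mem {a : Fin n → ℤ} {j : Fin n} (ha : a j ≠ 0)
    {f : MvPolynomial (Fin n) k} (hf : f ∈ fineDegree k a) :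
    X j * divMonomial f (Finsupp.single j 1) = f := by
  ext d
  by_cases hd : j ∈ d.support
  · rw [coeff_X_mul', if_pos hd, coeff_divMonomial]
    congr 1
    ext l
    by_cases hl : l = j
    · subst hl; simp at hd ⊢; omega
    · simp [Ne.symm hl]
  · rw [coeff_X_mul', if_neg hd]
    by_contra h
    have := congrFun (mem_fineDegree.1 hf d (Ne.symm h)) j
    simp only [Finsupp.mem_support_iff, not_not] at hd
    rw [hd] at this
    exact ha this.symm

/-! ### Homogeneous ideals, and ideals generated by powers of square-free monomials. -/

/-- An ideal is stable under taking homogeneous components. -/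
def IsFineHomogeneous (I : Ideal (MvPolynomial (Fin n) k)) : Prop :=
  ∀ f ∈ I, ∀ a, fineComponent k a f ∈ I

lemma isFineHomogeneous_span_monomial (s : Set (Fin n →₀ ℕ)) :
    IsFineHomogeneous (Ideal.span ((fun d => (monomial d (1 : k))) '' s)) := by
  intro f hf a
  rw [mem_ideal_span_monomial_image] at hf ⊢
  intro d hd
  rw [mem_support_iff] at hd
  exact hf d (mem_support_iff.2 (coeff_fineComponent_ne_zero hd))

lemma exists_sum_fineComponent (f : MvPolynomial (Fin n) k) :
    f ∈ AddSubgroup.closure {g | ∃ a, fineComponent k a g = g} := by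
  induction f using MvPolynomial.induction_on' with
  | monomial d r =>
    exact AddSubgroup.subset_closure ⟨_, fineComponent_same (monomial_mem_fineDegree d r)⟩
  | add p q hp hq => exact add_mem hp hq

lemma IsFineHomogeneous.mul {I J : Ideal (MvPolynomial (Fin n) k)} (hI : IsFineHomogeneous I)
    (hJ : IsFineHomogeneous J) : IsFineHomogeneous (I * J) := by
  classical
  let := weightedGradedAlgebra k (fun j : Fin n => (Pi.single j 1 : Fin n → ℤ))
  have key : ∀ I : Ideal (MvPolynomial (Fin n) k), IsFineHomogeneous I ↔
      I.IsHomogeneous (weightedHomogeneousSubmodule k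
        (fun j : Fin n => (Pi.single j 1 : Fin n → ℤ))) := by
    intro I
    constructor
    · intro h a f hf
      exact weightedDecomposition.decompose'_apply k _ f a ▸ h f hf a
    · intro h f hf a
      exact weightedDecomposition.decompose'_apply k _ f a ▸ h a hf
  rw [key] at *
  exact hI.mul hJ

lemma IsFineHomogeneous.pow {I : Ideal (MvPolynomial (Fin n) k)} (hI : IsFineHomogeneous I)
    (t : ℕ) : IsFineHomogeneous (I ^ t) := by
  induction t with
  | zero => simp [IsFineHomogeneous]
  | succ t ih => rw [pow_succ]; exact ih.mul hI

/-- The exponent vector of `∏_{j ∈ s} x_j ^ m`. -/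
def powIndicator (m : ℕ) (s : Finset (Fin n)) : Fin n →₀ ℕ :=
  ∑ j ∈ s, Finsupp.single j m

lemma powIndicator_apply (m : ℕ) (s : Finset (Fin n)) (l : Fin n) :
    powIndicator m s l = if l ∈ s then m else 0 := by
  simp [powIndicator, Finsupp.finsetSum_apply, Finsupp.single_apply]

lemma monomial_powIndicator (m : ℕ) (s : Finset (Fin n)) :
    monomial (powIndicator m s) (1 : k) = (∏ j ∈ s, X j) ^ m := by
  rw [powIndicator, monomial_sum_one, ← Finset.prod_pow]
  simp [X_pow_eq_monomial]

/-- The ideal generated by the `m`-th powers of the square-free monomials indexed by `A`. -/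
def powIdeal (k : Type u) [Field k] (A : Set (Finset (Fin n))) (m : ℕ) :
    Ideal (MvPolynomial (Fin n) k) :=
  Ideal.span ((fun d => monomial d (1 : k)) '' (powIndicator m '' A))

lemma powIdeal_le_pow (A : Set (Finset (Fin n))) (m t : ℕ) (h : t ≤ m) :
    powIdeal k A m ≤ (powIdeal k A 1) ^ t := by
  refine Ideal.span_le.2 ?_
  rintro _ ⟨_, ⟨s, hs, rfl⟩, rfl⟩
  refine Ideal.pow_le_pow_right h ?_
  simp only [monomial_powIndicator]
  have : (∏ j ∈ s, X j : MvPolynomial (Fin n) k) ∈ powIdeal k A 1 :=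
    Ideal.subset_span ⟨_, ⟨s, hs, rfl⟩, by simp [monomial_powIndicator]⟩
  exact Ideal.pow_mem_pow this _

/-- The `m`-th power of each generator lies on the right, and the left ideal is finitely generated.
With `powIdeal_le_pow`, this makes the two families of ideals cofinal. -/
lemma exists_pow_le_powIdeal (A : Set (Finset (Fin n))) (m : ℕ) :
    ∃ N, (powIdeal k A 1) ^ N ≤ powIdeal k A m := by
  refine Ideal.exists_pow_le_of_le_radical_of_fg ?_ (IsNoetherian.noetherian _)
  refine Ideal.span_le.2 ?_
  rintro _ ⟨_, ⟨s, hs, rfl⟩, rfl⟩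
  refine ⟨m, Ideal.subset_span ⟨_, ⟨s, hs, rfl⟩, ?_⟩⟩
  simp [monomial_powIndicator]

lemma IsSquarefreeMonomialIdeal.exists_eq_powIdeal {B : Ideal (MvPolynomial (Fin n) k)}
    (hB : IsSquarefreeMonomialIdeal B) : ∃ A, B = powIdeal k A 1 := by
  obtain ⟨A, rfl⟩ := hB
  refine ⟨A, ?_⟩
  rw [powIdeal, Set.image_image]
  simp [monomial_powIndicator]

lemma isFineHomogeneous_powIdeal (A : Set (Finset (Fin n))) (m : ℕ) :
    IsFineHomogeneous (powIdeal k A m) :=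
  isFineHomogeneous_span_monomial _

/-- The `x_j`-exponent of a generator is `0` or `m`. If `x_j * x^d` is a multiple of a generator and
`x^d` is not, then `d_j + 1 = m`, a multiple of `c`, which `ha` excludes. -/
lemma mem_powIdeal_of_X_mul_mem (A : Set (Finset (Fin n))) {c m : ℕ} (hc : c ∣ m) {j : Fin n}
    {a : Fin n → ℤ} (ha : ¬ (c : ℤ) ∣ a j + 1) {f : MvPolynomial (Fin n) k}
    (hf : f ∈ fineDegree k a) (h : X j * f ∈ powIdeal k A m) : f ∈ powIdeal k A m := by
  rw [powIdeal, mem_ideal_span_monomial_image] at h ⊢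
  intro d hd
  rw [mem_support_iff] at hd
  obtain ⟨e, ⟨s, hs, rfl⟩, he⟩ := h (Finsupp.single j 1 + d) (by rwa [mem_support_iff, coeff_X_mul])
  refine ⟨_, ⟨s, hs, rfl⟩, fun l => ?_⟩
  have hl := he l
  have hdj := congrFun (mem_fineDegree.1 hf d hd) j
  rw [powIndicator_apply] at hl ⊢
  by_cases hlj : l = j
  · subst hlj
    split_ifs at hl ⊢ with hls
    · have : (d l + 1 : ℕ) ≠ m := by
        rintro rfl
        apply ha
        rw [← hdj]
        exact_mod_cast hc
      simp at hl
      omega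
    · simp
  · simpa [Ne.symm hlj] using hl

/-! ### Graded modules. -/

/-- A `ℤⁿ`-graded module over `k[x_1, …, x_n]`, given by its projections to the homogeneous
components. -/
structure GrMod (k : Type u) [Field k] (n : ℕ) where
  /-- the underlying module -/
  carrier : Type u
  [addCommGroup : AddCommGroup carrier]
  [module : Module (MvPolynomial (Fin n) k) carrier]
  /-- the projection to a homogeneous component -/
  proj : (Fin n → ℤ) → carrier →+ carrier
  proj_proj : ∀ a x, proj a (proj a x) = proj a x
  proj_ne : ∀ a b x, a ≠ b → proj b (proj a x) = 0
  exists_sum : ∀ x, ∃ T : Finset (Fin n → ℤ), ∑ a ∈ T, proj a x = x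
  proj_smul : ∀ a b, ∀ s ∈ fineDegree k b, ∀ x, proj (b + a) (s • x) = s • proj a x

namespace GrMod

attribute [instance] GrMod.addCommGroup GrMod.module

lemma exists_sum_of_mem_closure {M : Type*} [AddCommGroup M] (proj : (Fin n → ℤ) → M →+ M)
    (proj_ne : ∀ a b x, a ≠ b → proj b (proj a x) = 0) {x : M}
    (hx : x ∈ AddSubgroup.closure {y | ∃ a, proj a y = y}) :
    ∃ T : Finset (Fin n → ℤ), ∑ a ∈ T, proj a x = x := by
  classical
  have mono : ∀ (T T' : Finset (Fin n → ℤ)) (x : M), T ⊆ T' → ∑ a ∈ T, proj a x = x →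
      ∑ a ∈ T', proj a x = x := by
    intro T T' x hT hx
    refine (Finset.sum_subset hT fun b _ hb => ?_).symm.trans hx
    rw [← hx, map_sum]
    exact Finset.sum_eq_zero fun a ha => proj_ne a b x fun h => hb (h ▸ ha)
  induction hx using AddSubgroup.closure_induction with
  | mem y hy => obtain ⟨a, ha⟩ := hy; exact ⟨{a}, by simpa using ha⟩
  | zero => exact ⟨∅, by simp⟩
  | add x y _ _ hx hy =>
    obtain ⟨T, hT⟩ := hx
    obtain ⟨U, hU⟩ := hy
    refine ⟨T ∪ U, ?_⟩
    simp_rw [map_add, Finset.sum_add_distrib]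
    rw [mono T _ x Finset.subset_union_left hT, mono U _ y Finset.subset_union_right hU]
  | neg x _ hx =>
    obtain ⟨T, hT⟩ := hx
    exact ⟨T, by simp [hT]⟩

variable (N : GrMod k n)

/-- The homogeneous component of degree `a`. -/
def part (a : Fin n → ℤ) : AddSubgroup N.carrier where
  carrier := {x | N.proj a x = x}
  add_mem' := fun {x y} (hx : _ = _) (hy : _ = _) => by simp [hx, hy]
  zero_mem' := by simp
  neg_mem' := fun {x} (hx : _ = _) => by simp [hx]

variable {N}

lemma mem_part {a : Fin n → ℤ} {x : N.carrier} : x ∈ N.part a ↔ N.proj a x = x := Iff.rfl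

lemma proj_mem (a : Fin n → ℤ) (x : N.carrier) : N.proj a x ∈ N.part a := N.proj_proj a x

lemma proj_of_mem_ne {a b : Fin n → ℤ} {x : N.carrier} (hx : x ∈ N.part a) (h : a ≠ b) :
    N.proj b x = 0 := by
  rw [← mem_part.1 hx, N.proj_ne _ _ _ h]

lemma smul_mem_part {a b : Fin n → ℤ} {s : MvPolynomial (Fin n) k} (hs : s ∈ fineDegree k b)
    {x : N.carrier} (hx : x ∈ N.part a) : s • x ∈ N.part (b + a) := by
  rw [mem_part, N.proj_smul _ _ _ hs, mem_part.1 hx]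

lemma mem_closure_part (x : N.carrier) : x ∈ ⨆ a, N.part a := by
  obtain ⟨T, hT⟩ := N.exists_sum x
  rw [← hT]
  exact sum_mem fun a _ => (le_iSup N.part a) (proj_mem a x)

/-- Homogeneous elements span: an induction principle. -/
lemma induction_part {p : N.carrier → Prop} (h0 : p 0) (hadd : ∀ x y, p x → p y → p (x + y))
    (hpart : ∀ a, ∀ x ∈ N.part a, p x) (x : N.carrier) : p x :=
  AddSubgroup.iSup_induction (C := p) N.part (mem_closure_part x) hpart h0 hadd

variable (N) in
lemma isInternal_part : DirectSum.IsInternal N.part := by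
  classical
  have key : ∀ (x : DirectSum _ fun a => N.part a) a,
      N.proj a (DirectSum.coeAddMonoidHom N.part x) = x a := by
    intro x a
    induction x using DirectSum.induction_on with
    | zero => simp
    | of b y =>
      rw [DirectSum.coeAddMonoidHom_of]
      by_cases h : b = a
      · subst h
        rw [DirectSum.of_eq_same]
        exact y.2
      · rw [proj_of_mem_ne y.2 h, DirectSum.of_eq_of_ne _ _ _ (Ne.symm h)]
        rfl
    | add x y hx hy => rw [map_add, map_add, hx, hy]; rfl
  constructor
  · intro x y hxy
    ext a
    rw [← key x, ← key y, hxy]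
  · intro x
    refine induction_part (p := fun x => ∃ y, DirectSum.coeAddMonoidHom N.part y = x) ⟨0, by simp⟩
      ?_ ?_ x
    · rintro _ _ ⟨x, rfl⟩ ⟨y, rfl⟩
      exact ⟨x + y, map_add _ _ _⟩
    · intro a x hx
      exact ⟨DirectSum.of (fun a => N.part a) a ⟨x, hx⟩, DirectSum.coeAddMonoidHom_of _ _ _⟩

/-! ### Tame modules. -/

/-- Multiplication by `x_j` is bijective on the components whose degree `a` does not satisfy
`c ∣ a_j + 1`. -/
structure IsTame (N : GrMod k n) (j : Fin n) (c : ℕ) : Prop where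
  inj : ∀ a : Fin n → ℤ, ¬ (c : ℤ) ∣ a j + 1 → ∀ x ∈ N.part a,
    (X j : MvPolynomial (Fin n) k) • x = 0 → x = 0
  surj : ∀ a : Fin n → ℤ, ¬ (c : ℤ) ∣ a j + 1 → ∀ y ∈ N.part (a + Pi.single j 1),
    ∃ x ∈ N.part a, (X j : MvPolynomial (Fin n) k) • x = y

/-- As long as `c ∤ a_j`, surjectivity out of degree `a - e_j` allows a division by `x_j`. After
`a_j mod c` divisions the degree is divisible by `c`, so such degrees generate a tame module. -/
lemma IsTame.exists_X_pow_smul {j : Fin n} {c : ℕ} (hN : N.IsTame j c) (hc : 0 < c)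
    {a : Fin n → ℤ} {y : N.carrier} (hy : y ∈ N.part a) :
    ∃ (r : ℕ) (b : Fin n → ℤ) (x : N.carrier), x ∈ N.part b ∧ (c : ℤ) ∣ b j ∧
      (X j : MvPolynomial (Fin n) k) ^ r • x = y := by
  obtain ⟨r, hr⟩ : ∃ r : ℕ, a j % c = r := ⟨_, (Int.toNat_of_nonneg
    (Int.emod_nonneg _ (by omega))).symm⟩
  have hrc : r < c := by
    have := Int.emod_lt_of_pos (a j) (show (0 : ℤ) < c by omega)
    omega
  induction r generalizing a y with
  | zero => exact ⟨0, a, y, hy, Int.dvd_of_emod_eq_zero hr, by simp⟩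
  | succ r ih =>
    obtain ⟨x, hx, rfl⟩ := hN.surj (a - Pi.single j 1) (by
      simp only [Pi.sub_apply, Pi.single_eq_same, sub_add_cancel]
      intro h
      rw [Int.emod_eq_zero_of_dvd h] at hr
      omega) y (by simpa using hy)
    obtain ⟨r', b, z, hz, hb, rfl⟩ := ih hx (by
      simp only [Pi.sub_apply, Pi.single_eq_same]
      have h1 : a j = c * (a j / c) + (r + 1 : ℕ) := by
        rw [← hr]; exact (Int.mul_ediv_add_emod _ _).symm
      rw [h1, show (c : ℤ) * (a j / c) + (r + 1 : ℕ) - 1 = r + c * (a j / c) by push_cast; ring,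
        Int.add_mul_emod_self_left]
      exact Int.emod_eq_of_lt (by omega) (by omega)) (by omega)
    exact ⟨r' + 1, b, z, hz, hb, by rw [pow_succ', mul_smul]⟩

section Quotient

variable {I : Ideal (MvPolynomial (Fin n) k)} (hI : IsFineHomogeneous I)

/-- The graded module `S / I`. -/
def quotient : GrMod k n where
  carrier := MvPolynomial (Fin n) k ⧸ I
  proj a := QuotientAddGroup.map I.toAddSubgroup I.toAddSubgroup (fineComponent k a).toAddMonoidHom
    fun f hf => hI f hf a
  proj_proj a := by
    rintro ⟨f⟩
    exact congrArg (Ideal.Quotient.mk I) (fineComponent_same (fineComponent_mem a f))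
  proj_ne a b := by
    rintro ⟨f⟩ h
    exact congrArg (Ideal.Quotient.mk I) (fineComponent_ne (fineComponent_mem a f) h)
  exists_sum := by
    rintro ⟨f⟩
    obtain ⟨T, hT⟩ := exists_sum_of_mem_closure (fun a => (fineComponent k a).toAddMonoidHom)
      (fun a b f h => fineComponent_ne (fineComponent_mem a f) h) (exists_sum_fineComponent f)
    refine ⟨T, ?_⟩
    exact (map_sum (Ideal.Quotient.mk I) _ _).symm.trans (congrArg (Ideal.Quotient.mk I) hT)
  proj_smul a b s hs := by
    rintro ⟨f⟩
    exact congrArg (Ideal.Quotient.mk I) (fineComponent_mul hs f)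

lemma quotient_mem_part {a : Fin n → ℤ} {x : MvPolynomial (Fin n) k ⧸ I} :
    x ∈ (quotient hI).part a ↔ ∃ f ∈ fineDegree k a, x = Ideal.Quotient.mk I f := by
  constructor
  · obtain ⟨f, rfl⟩ := Ideal.Quotient.mk_surjective x
    intro h
    exact ⟨_, fineComponent_mem a f, (mem_part.1 h).symm⟩
  · rintro ⟨f, hf, rfl⟩
    exact congrArg (Ideal.Quotient.mk I) (fineComponent_same hf)

/-- Only injectivity depends on `I`. Surjectivity comes from `S`: the target degree has nonzero
`j`-th coordinate because `c ∣ 0`. -/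
lemma isTame_quotient {j : Fin n} {c : ℕ}
    (h : ∀ (a : Fin n → ℤ), ¬ (c : ℤ) ∣ a j + 1 → ∀ f ∈ fineDegree k a, X j * f ∈ I → f ∈ I) :
    (quotient hI).IsTame j c where
  inj a ha x hx hX := by
    obtain ⟨f, hf, rfl⟩ := (quotient_mem_part hI).1 hx
    exact Ideal.Quotient.eq_zero_iff_mem.2 (h a ha f hf (Ideal.Quotient.eq_zero_iff_mem.1 hX))
  surj a ha y hy := by
    obtain ⟨f, hf, rfl⟩ := (quotient_mem_part hI).1 hy
    have h0 : (a + Pi.single j 1 : Fin n → ℤ) j ≠ 0 := by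
      intro h0
      simp only [Pi.add_apply, Pi.single_eq_same] at h0
      exact ha (h0 ▸ dvd_zero _)
    have hX := X_mul_divMonomial_of_mem h0 hf
    refine ⟨Ideal.Quotient.mk I (divMonomial f (Finsupp.single j 1)),
      (quotient_mem_part hI).2 ⟨_, ?_, rfl⟩, congrArg (Ideal.Quotient.mk I) hX⟩
    rwa [← X_mul_mem_fineDegree_iff, hX]

end Quotient

section Free

variable {G : Type u} (deg : G → Fin n → ℤ)

/-- The projection of a free module with homogeneous basis to a homogeneous component. -/
def freeProj (a : Fin n → ℤ) : (G →₀ MvPolynomial (Fin n) k) →+ (G →₀ MvPolynomial (Fin n) k) :=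
  Finsupp.liftAddHom fun g =>
    (Finsupp.singleAddHom g).comp (fineComponent k (a - deg g)).toAddMonoidHom

lemma freeProj_apply (a : Fin n → ℤ) (f : G →₀ MvPolynomial (Fin n) k) (g : G) :
    freeProj deg a f g = fineComponent k (a - deg g) (f g) := by
  classical
  induction f using Finsupp.induction_linear with
  | zero => simp
  | add f f' hf hf' => simp only [map_add, Finsupp.add_apply, hf, hf']
  | single g' s =>
    simp only [freeProj, Finsupp.liftAddHom_apply_single, AddMonoidHom.comp_apply,
      Finsupp.singleAddHom_apply, LinearMap.toAddMonoidHom_coe, Finsupp.single_apply]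
    split_ifs with h
    · rw [h]
    · simp

/-- The free graded module with a homogeneous basis of given degrees. -/
def free : GrMod k n where
  carrier := G →₀ MvPolynomial (Fin n) k
  proj := freeProj deg
  proj_proj a x := by
    ext1 g
    simp only [freeProj_apply, fineComponent_same (fineComponent_mem _ _)]
  proj_ne a b x h := by
    ext1 g
    simp only [freeProj_apply]
    exact fineComponent_ne (fineComponent_mem _ _) (by simpa using h)
  exists_sum x := by
    refine exists_sum_of_mem_closure _ ?_ ?_
    · intro a b x h
      ext1 g
      simp only [freeProj_apply]
      exact fineComponent_ne (fineComponent_mem _ _) (by simpa using h)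
    · induction x using Finsupp.induction_linear with
      | zero => exact zero_mem _
      | add f f' hf hf' => exact add_mem hf hf'
      | single g s =>
        induction s using MvPolynomial.induction_on' with
        | monomial d r =>
          refine AddSubgroup.subset_closure ⟨(fun j => (d j : ℤ)) + deg g, ?_⟩
          simp [freeProj, fineComponent_same (monomial_mem_fineDegree d r)]
        | add p q hp hq => rw [Finsupp.single_add]; exact add_mem hp hq
  proj_smul a b s hs x := by
    ext1 g
    simp only [freeProj_apply, Finsupp.smul_apply, smul_eq_mul]
    rw [add_sub_assoc, fineComponent_mul hs]

lemma mem_free_part {a : Fin n → ℤ} {f : G →₀ MvPolynomial (Fin n) k} :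
    f ∈ (free (k := k) deg).part a ↔ ∀ g, f g ∈ fineDegree k (a - deg g) := by
  constructor
  · intro h g
    rw [← mem_part.1 h]
    exact freeProj_apply deg a f g ▸ fineComponent_mem _ _
  · intro h
    refine Finsupp.ext fun g => ?_
    exact (freeProj_apply deg a f g).trans (fineComponent_same (h g))

lemma single_mem_free_part (g : G) :
    Finsupp.single g (1 : MvPolynomial (Fin n) k) ∈ (free (k := k) deg).part (deg g) := by
  classical
  rw [mem_free_part]
  intro g'
  rw [Finsupp.single_apply]
  split_ifs with h
  · subst h
    rw [sub_self]
    exact isWeightedHomogeneous_one _ _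
  · exact zero_mem _

/-- Injectivity holds in all degrees, `S` being a domain. For surjectivity, the coefficient at `g`
has `x_j`-degree `a_j + 1 - (deg g)_j`, which is nonzero since `c` divides `(deg g)_j` and not `a_j
+ 1`. -/
lemma isTame_free {j : Fin n} {c : ℕ} (h : ∀ g, (c : ℤ) ∣ deg g j) :
    (free (k := k) deg).IsTame j c where
  inj a _ x _ hX := by
    change G →₀ _ at x
    refine Finsupp.ext fun g => ?_
    replace hX : (X j : MvPolynomial (Fin n) k) • x = 0 := hX
    have : (X j : MvPolynomial (Fin n) k) * x g = 0 := DFunLike.congr_fun hX g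
    exact (mul_eq_zero.1 this).resolve_left (X_ne_zero j)
  surj a ha y hy := by
    change G →₀ _ at y
    replace hy := (mem_free_part deg).1 hy
    have hX : ∀ g, X j * divMonomial (y g) (Finsupp.single j 1) = y g := by
      intro g
      refine X_mul_divMonomial_of_mem ?_ (hy g)
      simp only [Pi.sub_apply, Pi.add_apply, Pi.single_eq_same]
      intro h0
      exact ha ((sub_eq_zero.1 h0) ▸ h g)
    refine ⟨Finsupp.mapRange (fun s => divMonomial s (Finsupp.single j 1))
      (zero_divMonomial _) y, ?_, Finsupp.ext fun g => ?_⟩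
    · refine (mem_free_part deg).2 fun g => ?_
      rw [Finsupp.mapRange_apply, ← X_mul_mem_fineDegree_iff (j := j), hX, sub_add_eq_add_sub]
      exact hy g
    · exact hX g

end Free

/-! ### Free covers of tame modules and their kernels. -/

section Syzygy

variable (N) (j : Fin n) (c : ℕ)

/-- The homogeneous elements of `N` whose degree `a` satisfies `c ∣ a_j`. -/
def Gens : Type u := {g : (a : Fin n → ℤ) × N.part a // (c : ℤ) ∣ g.1 j}

/-- The degree of a generator. -/
def Gens.deg {N : GrMod k n} {j : Fin n} {c : ℕ} (g : N.Gens j c) : Fin n → ℤ := g.1.1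

/-- The free graded module on the homogeneous elements of `N` whose degree `a` satisfies
`c ∣ a_j`. -/
abbrev cover : GrMod k n := free (k := k) (Gens.deg : N.Gens j c → _)

/-- The canonical map from the free cover. -/
def coverMap : (N.cover j c).carrier →ₗ[MvPolynomial (Fin n) k] N.carrier :=
  Finsupp.linearCombination (MvPolynomial (Fin n) k) fun g : N.Gens j c => (g.1.2 : N.carrier)

lemma coverMap_proj (a : Fin n → ℤ) (x : (N.cover j c).carrier) :
    N.coverMap j c ((N.cover j c).proj a x) = N.proj a (N.coverMap j c x) := by
  let F : (N.Gens j c →₀ MvPolynomial (Fin n) k) →+ N.carrier := (N.coverMap j c).toAddMonoidHom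
  suffices h : F.comp (freeProj Gens.deg a) = (N.proj a).comp F from DFunLike.congr_fun h x
  refine Finsupp.addHom_ext fun g s => ?_
  have hF : ∀ s, F (Finsupp.single g s) = s • (g.1.2 : N.carrier) :=
    fun s => Finsupp.linearCombination_single _ _ _
  have hg : (g.1.2 : N.carrier) ∈ N.part g.deg := g.1.2.2
  simp only [AddMonoidHom.comp_apply, freeProj, Finsupp.liftAddHom_apply_single,
    Finsupp.singleAddHom_apply, hF]
  simp only [LinearMap.toAddMonoidHom_coe]
  induction s using MvPolynomial.induction_on' with
  | monomial d r =>
    have := smul_mem_part (monomial_mem_fineDegree d r) hg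
    by_cases h : (fun j => (d j : ℤ)) = a - g.deg
    · rw [← h, fineComponent_same (monomial_mem_fineDegree d r)]
      rw [h, sub_add_cancel] at this
      exact this.symm
    · rw [fineComponent_ne (monomial_mem_fineDegree d r) h, zero_smul,
        proj_of_mem_ne this (fun h' => h (eq_sub_of_add_eq h'))]
  | add p q hp hq => rw [map_add, add_smul, add_smul, map_add, hp, hq]

lemma coverMap_mem_part {a : Fin n → ℤ} {x : (N.cover j c).carrier}
    (hx : x ∈ (N.cover j c).part a) : N.coverMap j c x ∈ N.part a := by
  rw [mem_part, ← coverMap_proj, mem_part.1 hx]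

variable {N j c} in
lemma IsTame.coverMap_surjective (hN : N.IsTame j c) (hc : 0 < c) :
    Function.Surjective (N.coverMap j c) := by
  intro x
  refine induction_part (p := fun x => ∃ y, N.coverMap j c y = x) ⟨0, map_zero _⟩
    ?_ ?_ x
  · rintro _ _ ⟨x, rfl⟩ ⟨y, rfl⟩
    exact ⟨x + y, map_add _ _ _⟩
  · intro a x hx
    obtain ⟨r, b, z, hz, hb, rfl⟩ := hN.exists_X_pow_smul hc hx
    exact ⟨Finsupp.single (⟨⟨b, z, hz⟩, hb⟩ : N.Gens j c) (X j ^ r),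
      Finsupp.linearCombination_single _ _ _⟩

/-- The kernel of the free cover, as a graded module. -/
def syzygy : GrMod k n where
  carrier := LinearMap.ker (N.coverMap j c)
  proj a := (((N.cover j c).proj a).comp
    (LinearMap.ker (N.coverMap j c)).subtype.toAddMonoidHom).codRestrict
      (LinearMap.ker (N.coverMap j c)) fun x => by
        have : N.coverMap j c x = 0 := x.2
        change N.coverMap j c ((N.cover j c).proj a x) = 0
        rw [coverMap_proj, this, map_zero]
  proj_proj a x := Subtype.ext ((N.cover j c).proj_proj a x)
  proj_ne a b x h := Subtype.ext ((N.cover j c).proj_ne a b x h)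
  exists_sum x := by
    obtain ⟨T, hT⟩ := (N.cover j c).exists_sum x
    refine ⟨T, Subtype.ext ?_⟩
    refine (map_sum (LinearMap.ker (N.coverMap j c)).subtype _ _).trans hT
  proj_smul a b s hs x := Subtype.ext ((N.cover j c).proj_smul a b s hs x)

lemma mem_syzygy_part {a : Fin n → ℤ} {x : (N.syzygy j c).carrier} :
    x ∈ (N.syzygy j c).part a ↔ x.1 ∈ (N.cover j c).part a :=
  Subtype.ext_iff

lemma isTame_cover : (N.cover j c).IsTame j c := isTame_free _ fun g => g.2

variable {N j c} in
-- An element of the kernel is divided by `x_j` in the free cover. The quotient maps to an element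
-- of `N` killed by `x_j` in a degree where `x_j` is injective, so it lies in the kernel.
lemma IsTame.syzygy (hN : N.IsTame j c) : (N.syzygy j c).IsTame j c where
  inj a ha x hx hX := Subtype.ext ((N.isTame_cover j c).inj a ha x.1
    ((N.mem_syzygy_part j c).1 hx) (congrArg Subtype.val hX))
  surj a ha y hy := by
    obtain ⟨x, hx, hxy⟩ := (N.isTame_cover j c).surj a ha y.1 ((N.mem_syzygy_part j c).1 hy)
    refine ⟨⟨x, ?_⟩, (N.mem_syzygy_part j c).2 hx, Subtype.ext hxy⟩
    refine hN.inj a ha _ (N.coverMap_mem_part j c hx) ?_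
    rw [← map_smul, hxy]
    exact y.2

end Syzygy

end GrMod

/-! ### The free resolution of a tame module. -/

namespace GrMod

/-- The iterated syzygies of a graded module. -/
def tower (N : GrMod k n) (j : Fin n) (c : ℕ) : ℕ → GrMod k n
  | 0 => N
  | i + 1 => (tower N j c i).syzygy j c

variable (N : GrMod k n) (j : Fin n) (c : ℕ)

variable {N j c} in
lemma IsTame.tower (hN : N.IsTame j c) : ∀ i, (N.tower j c i).IsTame j c
  | 0 => hN
  | i + 1 => (IsTame.tower hN i).syzygy

/-- The terms of the free resolution of `N`. -/
abbrev resTerm (i : ℕ) : GrMod k n := (N.tower j c i).cover j c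

/-- The differentials of the free resolution of `N`. -/
def resD (i : ℕ) : (N.resTerm j c (i + 1)).carrier →ₗ[MvPolynomial (Fin n) k]
    (N.resTerm j c i).carrier :=
  (LinearMap.ker ((N.tower j c i).coverMap j c)).subtype.comp
    ((N.tower j c (i + 1)).coverMap j c)

lemma coverMap_resD (i : ℕ) (x : (N.resTerm j c (i + 1)).carrier) :
    (N.tower j c i).coverMap j c (N.resD j c i x) = 0 :=
  ((N.tower j c (i + 1)).coverMap j c x : LinearMap.ker ((N.tower j c i).coverMap j c)).2

lemma resD_resD (i : ℕ) (x : (N.resTerm j c (i + 2)).carrier) :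
    N.resD j c i (N.resD j c (i + 1) x) = 0 :=
  congrArg Subtype.val (N.coverMap_resD j c (i + 1) x)

lemma resD_mem_part (i : ℕ) (a : Fin n → ℤ) (x : (N.resTerm j c (i + 1)).carrier)
    (hx : x ∈ (N.resTerm j c (i + 1)).part a) : N.resD j c i x ∈ (N.resTerm j c i).part a :=
  (mem_syzygy_part _ j c).1 (coverMap_mem_part _ j c hx)

variable {N j c} in
lemma IsTame.exists_resD_eq (hN : N.IsTame j c) (hc : 0 < c) (i : ℕ)
    (x : (N.resTerm j c i).carrier) (hx : (N.tower j c i).coverMap j c x = 0) :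
    ∃ y, N.resD j c i y = x := by
  obtain ⟨y, hy⟩ := (hN.tower (i + 1)).coverMap_surjective hc ⟨x, hx⟩
  exact ⟨y, congrArg Subtype.val hy⟩

/-- The free resolution of `N` as a chain complex. -/
def resComplex : ChainComplex (ModuleCat.{u} (MvPolynomial (Fin n) k)) ℕ :=
  ChainComplex.of (fun i => ModuleCat.of (MvPolynomial (Fin n) k) (N.resTerm j c i).carrier)
    (fun i => ModuleCat.ofHom (N.resD j c i))
    (fun i => by ext x; exact N.resD_resD j c i x)

lemma resComplex_d (i : ℕ) :
    (N.resComplex j c).d (i + 1) i = ModuleCat.ofHom (N.resD j c i) :=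
  ChainComplex.of_d (fun i => ModuleCat.of (MvPolynomial (Fin n) k) (N.resTerm j c i).carrier)
    (fun i => ModuleCat.ofHom (N.resD j c i)) i

lemma resComplex_d_hom (i : ℕ) (x : (N.resTerm j c (i + 1)).carrier) :
    ((N.resComplex j c).d (i + 1) i).hom x = N.resD j c i x := by
  rw [resComplex_d]
  rfl

/-- The augmentation of the free resolution of `N` in degree zero. -/
def resAug : (N.resComplex j c).X 0 ⟶ ModuleCat.of (MvPolynomial (Fin n) k) N.carrier :=
  ModuleCat.ofHom (N.coverMap j c)

lemma resComplex_d_resAug : (N.resComplex j c).d 1 0 ≫ N.resAug j c = 0 := by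
  rw [resComplex_d]
  ext x
  exact N.coverMap_resD j c 0 x

/-- The augmentation of the free resolution of `N`. -/
def resπ : N.resComplex j c ⟶
    (ChainComplex.single₀ _).obj (ModuleCat.of (MvPolynomial (Fin n) k) N.carrier) :=
  (ChainComplex.toSingle₀Equiv _ _).symm ⟨N.resAug j c, N.resComplex_d_resAug j c⟩

lemma resπ_f_zero : (N.resπ j c).f 0 = N.resAug j c :=
  ChainComplex.toSingle₀Equiv_symm_apply_f_zero _ (N.resComplex_d_resAug j c)

lemma resπ_hom (x : (N.resTerm j c 0).carrier) :
    ((N.resπ j c).f 0).hom x = N.coverMap j c x := by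
  rw [resπ_f_zero]
  rfl

variable {N j c} in
/-- The free resolution of a tame module. -/
def IsTame.resolution (hN : N.IsTame j c) (hc : 0 < c) :
    ProjectiveResolution (ModuleCat.of (MvPolynomial (Fin n) k) N.carrier) where
  complex := N.resComplex j c
  projective i := by
    have : Module.Free (MvPolynomial (Fin n) k) ((N.resComplex j c).X i) :=
      inferInstanceAs (Module.Free (MvPolynomial (Fin n) k)
        (((N.tower j c i).Gens j c) →₀ MvPolynomial (Fin n) k))
    exact ModuleCat.projective_of_categoryTheory_projective _
  π := N.resπ j c
  quasiIso := ⟨fun i => by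
    cases i with
    | zero =>
      rw [ChainComplex.quasiIsoAt₀_iff, ShortComplex.quasiIso_iff_of_zeros']
      · refine (ShortComplex.exact_and_epi_g_iff_of_iso (S₂ := ShortComplex.mk
          ((N.resComplex j c).d 1 0) (N.resAug j c) (N.resComplex_d_resAug j c)) ?_).2 ⟨?_, ?_⟩
        · exact ShortComplex.isoMk (Iso.refl _) (Iso.refl _) (Iso.refl _)
            ((Category.id_comp _).trans (Category.comp_id _).symm)
            (((Category.id_comp _).trans (N.resπ_f_zero j c).symm).trans (Category.comp_id _).symm)
        · rw [ShortComplex.moduleCat_exact_iff]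
          intro x hx
          obtain ⟨y, hy⟩ := hN.exists_resD_eq hc 0 x hx
          exact ⟨y, (N.resComplex_d_hom j c 0 y).trans hy⟩
        · exact (ModuleCat.epi_iff_surjective _).2 (hN.coverMap_surjective hc)
      all_goals rfl
    | succ i =>
      rw [quasiIsoAt_iff_exactAt']
      · rw [HomologicalComplex.exactAt_iff' _ (i + 1 + 1) (i + 1) i (by simp) (by simp),
          ShortComplex.moduleCat_exact_iff]
        intro x hx
        have hx' : N.resD j c i x = 0 := (N.resComplex_d_hom j c i x).symm.trans hx
        -- `resD` is a cover map followed by the inclusion of a kernel, so an element it kills is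
        -- already killed by the cover map.
        obtain ⟨y, hy⟩ := hN.exists_resD_eq hc (i + 1) x (Subtype.ext hx')
        exact ⟨y, (N.resComplex_d_hom j c (i + 1) y).trans hy⟩
      · exact ChainComplex.exactAt_succ_single_obj _ _⟩

end GrMod

variable {j : Fin n} {c : ℕ}

/-- The graded free resolution of `S / I`, when `S / I` is tame. -/
def GrMod.IsTame.gradedResolution {I : Ideal (MvPolynomial (Fin n) k)} {hI : IsFineHomogeneous I}
    (hN : (GrMod.quotient hI).IsTame j c) (hc : 0 < c) : GradedResolution I where
  res := hN.resolution hc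
  part i := ((GrMod.quotient hI).resTerm j c i).part
  isInternal i := GrMod.isInternal_part _
  gradedSMul i := ⟨fun _ _ _ _ ha hx => GrMod.smul_mem_part ha hx⟩
  d_mem i a x hx := (congrArg (· ∈ ((GrMod.quotient hI).resTerm j c i).part a)
    (GrMod.resComplex_d_hom _ j c i x)).mpr (GrMod.resD_mem_part _ j c i a x hx)
  π_mem a x hx := by
    obtain ⟨f, hf, h⟩ := (GrMod.quotient_mem_part hI).1 (GrMod.coverMap_mem_part _ j c hx)
    exact ⟨f, hf, (GrMod.resπ_hom _ j c x).trans h⟩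

/-! ### Degree-preserving comparison of resolutions. -/

/-- A homogeneous element in the image of a degree-preserving map is the image of a homogeneous
element. -/
lemma exists_mem_map_eq_of_isInternal {ι M N : Type*} [DecidableEq ι]
    [AddCommGroup M] [AddCommGroup N]
    {A : ι → AddSubgroup M} {B : ι → AddSubgroup N} (hA : ⨆ a, A a = ⊤)
    (hB : DirectSum.IsInternal B)
    (f : M →+ N) (hf : ∀ a, ∀ x ∈ A a, f x ∈ B a) (x : M) {a : ι} (hx : f x ∈ B a) :
    ∃ y ∈ A a, f y = f x := by
  classical
  let dB := hB.chooseDecomposition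
  have key : ∀ x : M, ∃ y ∈ A a, f y = (DirectSum.decompose B (f x) a : N) := by
    intro x
    have hx : x ∈ ⨆ a, A a := hA ▸ AddSubgroup.mem_top x
    refine AddSubgroup.iSup_induction A
      (C := fun x => ∃ y ∈ A a, f y = (DirectSum.decompose B (f x) a : N)) hx ?_ ?_ ?_
    · intro b z hz
      by_cases h : b = a
      · subst h
        exact ⟨z, hz, by rw [DirectSum.decompose_of_mem_same _ (hf _ _ hz)]⟩
      · exact ⟨0, zero_mem _, by rw [DirectSum.decompose_of_mem_ne _ (hf _ _ hz) h, map_zero]⟩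
    · exact ⟨0, zero_mem _, by simp⟩
    · rintro x y ⟨x', hx', hx⟩ ⟨y', hy', hy⟩
      exact ⟨x' + y', add_mem hx' hy', by simp [hx, hy]⟩
  obtain ⟨y, hy, h⟩ := key x
  exact ⟨y, hy, by rw [h, DirectSum.decompose_of_mem_same _ hx]⟩

lemma iSup_eq_top_of_isInternal {ι M : Type*} [DecidableEq ι] [AddCommGroup M]
    {A : ι → AddSubgroup M} (hA : DirectSum.IsInternal A) : ⨆ a, A a = ⊤ := by
  rw [eq_top_iff]
  intro x _
  obtain ⟨y, rfl⟩ := hA.2 x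
  induction y using DirectSum.induction_on with
  | zero => simp
  | of a y => rw [DirectSum.coeAddMonoidHom_of]; exact le_iSup A a y.2
  | add x y hx hy =>
    rw [map_add]
    exact add_mem (hx trivial) (hy trivial)

namespace GrMod

section FreeHom

variable {G : Type u} {deg : G → Fin n → ℤ} {M : Type*} [AddCommGroup M]
  [Module (MvPolynomial (Fin n) k) M] {A : (Fin n → ℤ) → AddSubgroup M}

/-- A linear map from a graded free module that is homogeneous on the basis is homogeneous. -/
lemma map_free_mem
    (hA : ∀ a b, ∀ s ∈ fineDegree k a, ∀ x ∈ A b, s • x ∈ A (a + b)) {p : Fin n → ℤ}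
    (φ : (free (k := k) deg).carrier →ₗ[MvPolynomial (Fin n) k] M)
    (h : ∀ g, φ (Finsupp.single g 1 : G →₀ _) ∈ A (deg g + p)) {a : Fin n → ℤ}
    {x : (free (k := k) deg).carrier} (hx : x ∈ (free (k := k) deg).part a) :
    φ x ∈ A (a + p) := by
  change G →₀ MvPolynomial (Fin n) k at x
  let φ' : (G →₀ MvPolynomial (Fin n) k) →ₗ[MvPolynomial (Fin n) k] M := φ
  have hx' := (mem_free_part deg).1 hx
  change φ' x ∈ A (a + p)
  rw [← Finsupp.sum_single x, Finsupp.sum, map_sum]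
  refine sum_mem fun g _ => ?_
  rw [← mul_one (x g), ← smul_eq_mul, ← Finsupp.smul_single, map_smul]
  have := hA _ _ _ (hx' g) _ (h g)
  rwa [← add_assoc, sub_add_cancel] at this

end FreeHom

end GrMod

namespace GradedResolution

variable {I : Ideal (MvPolynomial (Fin n) k)} (P : GradedResolution I)

/-- The augmentation of a graded resolution. -/
def aug : P.res.complex.X 0 →ₗ[MvPolynomial (Fin n) k] MvPolynomial (Fin n) k ⧸ I :=
  (P.res.π.f 0).hom

lemma aug_surjective : Function.Surjective P.aug :=
  (ModuleCat.epi_iff_surjective (P.res.π.f 0)).1 inferInstance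

lemma exists_d_eq_of_aug_eq_zero (x : P.res.complex.X 0) (hx : P.aug x = 0) :
    ∃ y, (P.res.complex.d 1 0).hom y = x :=
  (ShortComplex.moduleCat_exact_iff _).1 P.res.exact₀ x hx

lemma exists_d_eq_of_d_eq_zero (i : ℕ) (x : P.res.complex.X (i + 1))
    (hx : (P.res.complex.d (i + 1) i).hom x = 0) :
    ∃ y, (P.res.complex.d (i + 2) (i + 1)).hom y = x :=
  (ShortComplex.moduleCat_exact_iff _).1 (P.res.exact_succ i) x hx

lemma smul_mem_part (i : ℕ) (a b : Fin n → ℤ) (s : MvPolynomial (Fin n) k)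
    (hs : s ∈ fineDegree k a) (x : P.res.complex.X i) (hx : x ∈ P.part i b) :
    s • x ∈ P.part i (a + b) :=
  (P.gradedSMul i).smul_mem hs hx

lemma iSup_part (i : ℕ) : ⨆ a, P.part i a = ⊤ := iSup_eq_top_of_isInternal (P.isInternal i)

lemma exists_mem_part_d_eq (i : ℕ) {a : Fin n → ℤ} {x : P.res.complex.X i}
    (hx : x ∈ P.part i a) (h : ∃ y, (P.res.complex.d (i + 1) i).hom y = x) :
    ∃ y ∈ P.part (i + 1) a, (P.res.complex.d (i + 1) i).hom y = x := by
  obtain ⟨y, rfl⟩ := h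
  exact exists_mem_map_eq_of_isInternal (P.iSup_part (i + 1)) (P.isInternal i)
    (P.res.complex.d (i + 1) i).hom.toAddMonoidHom (P.d_mem i) y hx

lemma exists_mem_part_aug_eq (hI : IsFineHomogeneous I) {a : Fin n → ℤ}
    {f : MvPolynomial (Fin n) k} (hf : f ∈ fineDegree k a) :
    ∃ y ∈ P.part 0 a, P.aug y = Ideal.Quotient.mk I f := by
  obtain ⟨y, hy⟩ := P.aug_surjective (Ideal.Quotient.mk I f)
  rw [← hy]
  refine exists_mem_map_eq_of_isInternal (B := (GrMod.quotient hI).part) (P.iSup_part 0)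
    (GrMod.isInternal_part (GrMod.quotient hI)) P.aug.toAddMonoidHom ?_ y ?_
  · intro b x hx
    exact (GrMod.quotient_mem_part hI).2 (P.π_mem b x hx)
  · exact (GrMod.quotient_mem_part hI).2 ⟨f, hf, hy⟩

end GradedResolution

namespace GrMod.IsTame

variable {j : Fin n} {c : ℕ} {I I' : Ideal (MvPolynomial (Fin n) k)} {hI : IsFineHomogeneous I}
  (hN : (GrMod.quotient hI).IsTame j c) (hc : 0 < c)

/-- A degree-preserving linear map between the terms of two resolutions that carries boundaries to
boundaries. -/
structure Lift (P : GradedResolution I') (i : ℕ) where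
  /-- the linear map -/
  map : ((GrMod.quotient hI).resTerm j c i).carrier →ₗ[MvPolynomial (Fin n) k] P.res.complex.X i
  map_mem : ∀ a, ∀ x ∈ ((GrMod.quotient hI).resTerm j c i).part a, map x ∈ P.part i a
  -- Kept as part of the data, since it is what the extension to `i + 1` needs.
  exists_d_eq : ∀ x, ∃ y, (P.res.complex.d (i + 1) i).hom y =
    map ((GrMod.quotient hI).resD j c i x)

/-- Construct a linear map out of a term of the free resolution by choosing homogeneous images of
the basis elements. -/
lemma exists_resTerm_hom (P : GradedResolution I') (i : ℕ) (N : GrMod k n) {M : Type u}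
    [AddCommGroup M] [Module (MvPolynomial (Fin n) k) M]
    (ψ : (N.cover j c).carrier →ₗ[MvPolynomial (Fin n) k] M)
    (δ : P.res.complex.X i →ₗ[MvPolynomial (Fin n) k] M)
    (h : ∀ a, ∀ x ∈ (N.cover j c).part a, ∃ y ∈ P.part i a, δ y = ψ x) :
    ∃ φ : (N.cover j c).carrier →ₗ[MvPolynomial (Fin n) k] P.res.complex.X i,
      (∀ a, ∀ x ∈ (N.cover j c).part a, φ x ∈ P.part i a) ∧ ∀ x, δ (φ x) = ψ x := by
  choose y hy hδ using fun g : N.Gens j c => h _ _ (single_mem_free_part Gens.deg g)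
  let φ : (N.cover j c).carrier →ₗ[MvPolynomial (Fin n) k] P.res.complex.X i :=
    Finsupp.linearCombination (MvPolynomial (Fin n) k) y
  have hφ : ∀ g : N.Gens j c, φ (Finsupp.single g 1 : N.Gens j c →₀ _) = y g := fun g =>
    (Finsupp.linearCombination_single _ _ _).trans (one_smul _ _)
  refine ⟨φ, fun a x hx => ?_, fun x => ?_⟩
  · have := map_free_mem (P.smul_mem_part i) (p := 0) φ
      (fun g => by rw [hφ, add_zero]; exact hy g) hx
    rwa [add_zero] at this
  · have : δ ∘ₗ φ = ψ := by
      refine Finsupp.lhom_ext' fun g => LinearMap.ext_ring ?_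
      exact (congrArg δ (hφ g)).trans (hδ g)
    exact LinearMap.congr_fun this x

/-- The usual lifting along an exact complex, with each basis element sent to a homogeneous
preimage, so that degrees are preserved. -/
lemma Lift.exists_succ {P : GradedResolution I'} {i : ℕ}
    (φ : Lift (j := j) (c := c) (hI := hI) P i) :
    ∃ φ' : Lift (j := j) (c := c) (hI := hI) P (i + 1), ∀ x,
      (P.res.complex.d (i + 1) i).hom (φ'.map x) = φ.map ((GrMod.quotient hI).resD j c i x) := by
  obtain ⟨φ', h1, h2⟩ := exists_resTerm_hom P (i + 1) _
    (φ.map ∘ₗ (GrMod.quotient hI).resD j c i) (P.res.complex.d (i + 1) i).hom (by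
      intro a x hx
      exact P.exists_mem_part_d_eq i (φ.map_mem _ _ (resD_mem_part _ j c i a x hx))
        (φ.exists_d_eq x))
  refine ⟨⟨φ', h1, fun x => P.exists_d_eq_of_d_eq_zero i _ ?_⟩, h2⟩
  rw [h2, LinearMap.comp_apply, resD_resD, map_zero]

/-- The augmentation of the free resolution of `S / I`, followed by `S / I → S / I'`. -/
def coverMapFactor (h : I ≤ I') : ((GrMod.quotient hI).cover j c).carrier
    →ₗ[MvPolynomial (Fin n) k] MvPolynomial (Fin n) k ⧸ I' :=
  let ψ : (GrMod.quotient hI).carrier →ₗ[MvPolynomial (Fin n) k] MvPolynomial (Fin n) k ⧸ I' :=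
    Submodule.mapQ I I' LinearMap.id h
  ψ ∘ₗ (GrMod.quotient hI).coverMap j c

lemma coverMapFactor_apply (h : I ≤ I') (x : ((GrMod.quotient hI).cover j c).carrier)
    (f : MvPolynomial (Fin n) k)
    (hf : (GrMod.quotient hI).coverMap j c x = Ideal.Quotient.mk I f) :
    coverMapFactor h x = Ideal.Quotient.mk I' f :=
  congrArg (Submodule.mapQ I I' LinearMap.id h) hf

lemma Lift.exists_zero (P : GradedResolution I') (hI' : IsFineHomogeneous I') (h : I ≤ I') :
    ∃ φ : Lift (j := j) (c := c) (hI := hI) P 0, ∀ x, P.aug (φ.map x) = coverMapFactor h x := by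
  obtain ⟨φ, h1, h2⟩ := exists_resTerm_hom P 0 (GrMod.quotient hI)
    (coverMapFactor (j := j) (c := c) h) P.aug (by
      intro a x hx
      obtain ⟨f, hf, hfx⟩ := (quotient_mem_part hI).1 (coverMap_mem_part _ j c hx)
      rw [coverMapFactor_apply h x f hfx]
      exact P.exists_mem_part_aug_eq hI' hf)
  refine ⟨⟨φ, h1, fun x => P.exists_d_eq_of_aug_eq_zero _ ?_⟩, h2⟩
  refine (h2 _).trans ((coverMapFactor_apply h _ 0 ?_).trans (map_zero _))
  exact (coverMap_resD (GrMod.quotient hI) j c 0 x).trans (map_zero _).symm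

/-- The compatible sequence of lifts starting with a given one. -/
def Lift.seq {P : GradedResolution I'} (φ : Lift (j := j) (c := c) (hI := hI) P 0) :
    ∀ i, Lift (j := j) (c := c) (hI := hI) P i
  | 0 => φ
  | i + 1 => (Lift.seq φ i).exists_succ.choose

lemma Lift.d_seq {P : GradedResolution I'} (φ : Lift (j := j) (c := c) (hI := hI) P 0)
    (i : ℕ) (x : ((GrMod.quotient hI).resTerm j c (i + 1)).carrier) :
    (P.res.complex.d (i + 1) i).hom ((φ.seq (i + 1)).map x) =
      (φ.seq i).map ((GrMod.quotient hI).resD j c i x) :=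
  (φ.seq i).exists_succ.choose_spec x

/-- The quotient map `S / I → S / I'`. -/
abbrev quotientMap (h : I ≤ I') :
    ModuleCat.of (MvPolynomial (Fin n) k) (MvPolynomial (Fin n) k ⧸ I) ⟶
      ModuleCat.of (MvPolynomial (Fin n) k) (MvPolynomial (Fin n) k ⧸ I') :=
  ModuleCat.ofHom (Submodule.mapQ I I' LinearMap.id h)

/-- The free resolution of `S / I` maps to every graded resolution of `S / I'`, for `I ≤ I'`, by a
degree-preserving chain map. -/
lemma exists_gradedChainMap (P : GradedResolution I') (hI' : IsFineHomogeneous I') (h : I ≤ I') :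
    ∃ φ : (hN.gradedResolution hc).res.complex ⟶ P.res.complex,
      (∀ i a, ∀ x ∈ (hN.gradedResolution hc).part i a, (φ.f i).hom x ∈ P.part i a) ∧
      φ.f 0 ≫ P.res.π.f 0 = (hN.gradedResolution hc).res.π.f 0 ≫ quotientMap h := by
  obtain ⟨φ, hφ⟩ := Lift.exists_zero (j := j) (c := c) (hI := hI) P hI' h
  refine ⟨⟨fun i => ModuleCat.ofHom (φ.seq i).map, ?_⟩, fun i => (φ.seq i).map_mem, ?_⟩
  · rintro _ i rfl
    ext x
    exact (φ.d_seq i x).trans (congrArg _ (resComplex_d_hom _ j c i x)).symm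
  · ext x
    refine (hφ x).trans ?_
    refine Eq.trans ?_ (congrArg (quotientMap h).hom (resπ_hom _ j c x)).symm
    rfl

end GrMod.IsTame

/-! ### Functoriality of Ext in terms of chain maps. -/

section ExtFunctoriality

universe v w

variable {R : Type*} [Ring R] {C : Type w} [Category.{v} C] [Abelian C] [Linear R C]

/-- The map of Hom complexes induced by a chain map. -/
def linearYonedaMap {K L : ChainComplex C ℕ} (φ : K ⟶ L) (Y : C) :
    L.linearYonedaObj R Y ⟶ K.linearYonedaObj R Y :=
  (HomologicalComplex.unopFunctor _ _).map
    ((((linearYoneda R C).obj Y).rightOp.mapHomologicalComplex _).map φ).op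

lemma homologyMap_unop_homologyUnop {V ι : Type*} [Category V] [Abelian V] {c : ComplexShape ι}
    {K L : HomologicalComplex Vᵒᵖ c} (ψ : K ⟶ L) (i : ι) :
    HomologicalComplex.homologyMap ((HomologicalComplex.unopFunctor V c).map ψ.op) i ≫
      (K.homologyUnop i).hom =
    (L.homologyUnop i).hom ≫ (HomologicalComplex.homologyMap ψ i).unop :=
  (congrArg Quiver.Hom.unop (ShortComplex.homologyOpIso_hom_naturality
    ((HomologicalComplex.shortComplexFunctor V c.symm i).map
      ((HomologicalComplex.unopFunctor V c).map ψ.op)))).symm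

variable [EnoughProjectives C]

lemma isoExt_inv_naturality {X X' : C} (f : X ⟶ X') (P : ProjectiveResolution X)
    (Q : ProjectiveResolution X') (φ : P.complex ⟶ Q.complex)
    (comm : φ.f 0 ≫ Q.π.f 0 = P.π.f 0 ≫ f) (i : ℕ) (Y : C) :
    (Q.isoExt i Y).inv ≫ ((Ext R C i).map f.op).app Y =
      HomologicalComplex.homologyMap (linearYonedaMap φ Y) i ≫ (P.isoExt i Y).inv := by
  have h := congrArg Quiver.Hom.unop (ProjectiveResolution.isoLeftDerivedObj_hom_naturality f P Q φ
    comm ((linearYoneda R C).obj Y).rightOp i)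
  have h' := homologyMap_unop_homologyUnop
    ((((linearYoneda R C).obj Y).rightOp.mapHomologicalComplex _).map φ) i
  -- Ext is the left derived functor of `Hom(-, Y)` with values in the opposite category; `isoExt`
  -- is the comparison for that functor, carried back by `unop`.
  have e1 : ∀ {X : C} (P : ProjectiveResolution X), (P.isoExt (R := R) i Y).inv =
      (HomologicalComplex.homologyUnop _ _).hom ≫
        (P.isoLeftDerivedObj ((linearYoneda R C).obj Y).rightOp i).hom.unop := by
    intro X P
    rfl
  rw [e1, e1]
  refine (Category.assoc _ _ _).trans ((congrArg _ h).trans ?_)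
  refine (Category.assoc _ _ _).symm.trans ((congrArg (· ≫ _) h'.symm).trans ?_)
  exact Category.assoc _ _ _

end ExtFunctoriality

/-! ### Cocycles representing Ext classes. -/

section Classes

variable {X : ModuleCat.{u} (MvPolynomial (Fin n) k)}

/-- `Ext^i_S(X, S)`. -/
abbrev ExtS (i : ℕ) (X : ModuleCat.{u} (MvPolynomial (Fin n) k)) :
    ModuleCat (MvPolynomial (Fin n) k) :=
  ((Ext (MvPolynomial (Fin n) k) (ModuleCat.{u} (MvPolynomial (Fin n) k)) i).obj
      (Opposite.op X)).obj (polyModule k n)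

/-- A cochain represents an element of `Ext^i(X, S)` on a projective resolution of `X`. -/
def Represents (P : ProjectiveResolution X) (i : ℕ) (f : P.complex.X i ⟶ polyModule k n)
    (e : ExtS i X) : Prop :=
  ∃ z : (P.complex.linearYonedaObj (MvPolynomial (Fin n) k) (polyModule k n)).cycles i,
    ((P.complex.linearYonedaObj (MvPolynomial (Fin n) k) (polyModule k n)).iCycles i).hom z = f ∧
    (P.isoExt i (polyModule k n)).inv.hom
      (((P.complex.linearYonedaObj (MvPolynomial (Fin n) k) (polyModule k n)).homologyπ i).hom
        z) = e

variable {P : ProjectiveResolution X} {i : ℕ}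

lemma Represents.add {f g : P.complex.X i ⟶ polyModule k n} {e e' : ExtS i X}
    (h : Represents P i f e) (h' : Represents P i g e') : Represents P i (f + g) (e + e') := by
  obtain ⟨z, rfl, rfl⟩ := h
  obtain ⟨z', rfl, rfl⟩ := h'
  exact ⟨z + z', map_add _ _ _, by simp only [map_add]⟩

lemma Represents.smul {f : P.complex.X i ⟶ polyModule k n} {e : ExtS i X}
    (h : Represents P i f e) (s : MvPolynomial (Fin n) k) : Represents P i (s • f) (s • e) := by
  obtain ⟨z, rfl, rfl⟩ := h
  exact ⟨s • z, map_smul _ _ _, by simp only [map_smul]⟩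

lemma represents_zero : Represents P i 0 (0 : ExtS i X) :=
  ⟨0, map_zero _, by simp only [map_zero]⟩

lemma exists_represents (f : P.complex.X i ⟶ polyModule k n)
    (h : P.complex.d (i + 1) i ≫ f = 0) : ∃ e, Represents P i f e := by
  let K := P.complex.linearYonedaObj (MvPolynomial (Fin n) k) (polyModule k n)
  -- The cochain `f` becomes the map from `S` with `1 ↦ f`, so that the universal property of cycles
  -- applies.
  let F : ModuleCat.of (MvPolynomial (Fin n) k) (MvPolynomial (Fin n) k) ⟶ K.X i :=
    ModuleCat.ofHom (LinearMap.toSpanSingleton (MvPolynomial (Fin n) k) (K.X i) f)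
  have hF : F ≫ K.d i (i + 1) = 0 := by
    ext
    exact (congrArg (P.complex.d (i + 1) i ≫ ·) (one_smul (MvPolynomial (Fin n) k) f)).trans h
  refine ⟨_, (K.liftCycles F (i + 1) (by simp) hF).hom 1, ?_, rfl⟩
  exact (congrArg (fun g => g.hom 1) (K.liftCycles_i F (i + 1) (by simp) hF)).trans
    (one_smul (MvPolynomial (Fin n) k) f)

lemma Represents.d_comp {f : P.complex.X i ⟶ polyModule k n} {e : ExtS i X}
    (h : Represents P i f e) : P.complex.d (i + 1) i ≫ f = 0 := by
  obtain ⟨z, rfl, rfl⟩ := h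
  let K := P.complex.linearYonedaObj (MvPolynomial (Fin n) k) (polyModule k n)
  exact congrArg (fun g => g.hom z) (K.iCycles_d i (i + 1))

/-- For `i = 0` the convention `prev 0 = 0` makes the differential zero, so the criterion reads `f =
0`, as it should. -/
lemma Represents.eq_zero_iff {f : P.complex.X i ⟶ polyModule k n} {e : ExtS i X}
    (h : Represents P i f e) :
    e = 0 ↔ ∃ v, f = P.complex.d i ((ComplexShape.up ℕ).prev i) ≫ v := by
  obtain ⟨z, rfl, rfl⟩ := h
  let K := P.complex.linearYonedaObj (MvPolynomial (Fin n) k) (polyModule k n)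
  have hex := (ShortComplex.moduleCat_exact_iff _).1 (ShortComplex.exact_of_g_is_cokernel
    (ShortComplex.mk _ _ (K.toCycles_comp_homologyπ ((ComplexShape.up ℕ).prev i) i))
      (K.homologyIsCokernel _ i rfl))
  have hi : ∀ v, (K.iCycles i).hom ((K.toCycles ((ComplexShape.up ℕ).prev i) i).hom v) =
      P.complex.d i ((ComplexShape.up ℕ).prev i) ≫ v := fun v =>
    congrArg (fun g => g.hom v) (K.toCycles_i ((ComplexShape.up ℕ).prev i) i)
  have hinj : Function.Injective (K.iCycles i).hom :=
    (ModuleCat.mono_iff_injective (K.iCycles i)).1 inferInstance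
  have hiso : Function.Injective
      (P.isoExt (R := MvPolynomial (Fin n) k) i (polyModule k n)).inv.hom :=
    (ModuleCat.mono_iff_injective _).1 inferInstance
  constructor
  · intro h0
    obtain ⟨v, hv⟩ := hex z (hiso (h0.trans (map_zero _).symm))
    exact ⟨v, (congrArg _ hv).symm.trans (hi v)⟩
  · rintro ⟨v, hv⟩
    have hz : z = (K.toCycles ((ComplexShape.up ℕ).prev i) i).hom v :=
      hinj (hv.trans (hi v).symm)
    have h0 : (K.homologyπ i).hom z = 0 := by
      rw [hz]
      exact congrArg (fun g => g.hom v) (K.toCycles_comp_homologyπ _ i)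
    exact (congrArg _ h0).trans (map_zero _)

lemma Represents.map {X' : ModuleCat.{u} (MvPolynomial (Fin n) k)} {Q : ProjectiveResolution X'}
    {g : X ⟶ X'} {φ : P.complex ⟶ Q.complex} (comm : φ.f 0 ≫ Q.π.f 0 = P.π.f 0 ≫ g)
    {f : Q.complex.X i ⟶ polyModule k n} {e : ExtS i X'} (h : Represents Q i f e) :
    Represents P i (φ.f i ≫ f) ((((Ext (MvPolynomial (Fin n) k)
      (ModuleCat.{u} (MvPolynomial (Fin n) k)) i).map g.op).app (polyModule k n)).hom e) := by
  obtain ⟨z, rfl, rfl⟩ := h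
  let ψ := linearYonedaMap (R := MvPolynomial (Fin n) k) φ (polyModule k n)
  refine ⟨(HomologicalComplex.cyclesMap ψ i).hom z, ?_, ?_⟩
  · exact congrArg (fun g => g.hom z) (HomologicalComplex.cyclesMap_i ψ i)
  · have h1 := congrArg (fun g => g.hom z) (HomologicalComplex.homologyπ_naturality ψ i)
    have h2 := congrArg (fun g => g.hom (((Q.complex.linearYonedaObj (MvPolynomial (Fin n) k)
      (polyModule k n)).homologyπ i).hom z)) (isoExt_inv_naturality (R := MvPolynomial (Fin n) k)
        g P Q φ comm i (polyModule k n))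
    exact (congrArg (P.isoExt i (polyModule k n)).inv.hom h1.symm).trans h2.symm

lemma Represents.unique {f : P.complex.X i ⟶ polyModule k n} {e e' : ExtS i X}
    (h : Represents P i f e) (h' : Represents P i f e') : e = e' := by
  have := h.add (h'.smul (-1))
  rw [← sub_eq_zero, sub_eq_add_neg, ← neg_one_smul (MvPolynomial (Fin n) k), this.eq_zero_iff]
  exact ⟨0, by simp⟩

end Classes

/-! ### Homogeneous maps from free covers to `S`. -/

namespace GrMod

variable {N : GrMod k n} {j : Fin n} {c : ℕ}

/-- A map from the free cover to `S` that is homogeneous on the basis is homogeneous. -/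
lemma cover_hom_mem {p : Fin n → ℤ}
    (φ : (N.cover j c).carrier →ₗ[MvPolynomial (Fin n) k] MvPolynomial (Fin n) k)
    (h : ∀ g : N.Gens j c, φ (Finsupp.single g 1 : N.Gens j c →₀ _) ∈ fineDegree k (g.deg + p))
    {a : Fin n → ℤ} {x : (N.cover j c).carrier} (hx : x ∈ (N.cover j c).part a) :
    φ x ∈ fineDegree k (a + p) :=
  map_free_mem (A := fun a => (fineDegree k a).toAddSubgroup)
    (fun _ _ _ hs _ hx => mul_mem_fineDegree hs hx) φ h hx

lemma exists_X_mul_cover_hom {p : Fin n → ℤ} (hp : ¬ (c : ℤ) ∣ p j + 1)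
    (φ : (N.cover j c).carrier →ₗ[MvPolynomial (Fin n) k] MvPolynomial (Fin n) k)
    (h : ∀ a, ∀ x ∈ (N.cover j c).part a, φ x ∈ fineDegree k (a + (p + Pi.single j 1))) :
    ∃ φ' : (N.cover j c).carrier →ₗ[MvPolynomial (Fin n) k] MvPolynomial (Fin n) k,
      (∀ a, ∀ x ∈ (N.cover j c).part a, φ' x ∈ fineDegree k (a + p)) ∧
      ∀ x, X j * φ' x = φ x := by
  let b : N.Gens j c → (N.cover j c).carrier := fun g => (Finsupp.single g 1 : N.Gens j c →₀ _)
  have hb : ∀ g, φ (b g) ∈ fineDegree k (g.deg + (p + Pi.single j 1)) :=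
    fun g => h _ _ (single_mem_free_part Gens.deg g)
  have hX : ∀ g, X j * divMonomial (φ (b g)) (Finsupp.single j 1) = φ (b g) := by
    intro g
    refine X_mul_divMonomial_of_mem ?_ (hb g)
    simp only [Pi.add_apply, Pi.single_eq_same]
    intro h0
    -- If the `j`-th degree `(deg g)_j + p_j + 1` of the value were `0`, then `c ∣ (deg g)_j` would
    -- force `c ∣ p_j + 1`.
    exact hp ((Int.dvd_add_right g.2).1 (h0 ▸ dvd_zero _))
  let φ' : (N.cover j c).carrier →ₗ[MvPolynomial (Fin n) k] MvPolynomial (Fin n) k :=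
    Finsupp.linearCombination (MvPolynomial (Fin n) k)
      fun g => divMonomial (φ (b g)) (Finsupp.single j 1)
  have hφ' : ∀ g, φ' (b g) = divMonomial (φ (b g)) (Finsupp.single j 1) := fun g =>
    (Finsupp.linearCombination_single _ _ _).trans (one_smul _ _)
  refine ⟨φ', fun a x hx => cover_hom_mem φ' (fun g => ?_) hx, fun x => ?_⟩
  · change φ' (b g) ∈ _
    rw [hφ', ← X_mul_mem_fineDegree_iff (j := j), hX, add_assoc]
    exact hb g
  · have : (X j : MvPolynomial (Fin n) k) • φ' = φ := by
      refine Finsupp.lhom_ext' fun g => LinearMap.ext_ring ?_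
      exact (congrArg (X j * ·) (hφ' g)).trans (hX g)
    exact LinearMap.congr_fun this x

/-- The component of degree `p` of a map from the free cover to `S`. -/
lemma exists_component_cover_hom (p : Fin n → ℤ)
    (φ : (N.cover j c).carrier →ₗ[MvPolynomial (Fin n) k] MvPolynomial (Fin n) k) :
    ∃ φ' : (N.cover j c).carrier →ₗ[MvPolynomial (Fin n) k] MvPolynomial (Fin n) k,
      ∀ a, ∀ x ∈ (N.cover j c).part a, φ' x = fineComponent k (a + p) (φ x) := by
  let b : N.Gens j c → (N.cover j c).carrier := fun g => (Finsupp.single g 1 : N.Gens j c →₀ _)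
  let φ' : (N.Gens j c →₀ MvPolynomial (Fin n) k) →ₗ[MvPolynomial (Fin n) k]
      MvPolynomial (Fin n) k :=
    Finsupp.linearCombination (MvPolynomial (Fin n) k)
      fun g => fineComponent k (g.deg + p) (φ (b g))
  let ψ : (N.Gens j c →₀ MvPolynomial (Fin n) k) →ₗ[MvPolynomial (Fin n) k]
      MvPolynomial (Fin n) k := φ
  refine ⟨φ', fun a x hx => ?_⟩
  change (N.Gens j c →₀ _) at x
  replace hx := (mem_free_part Gens.deg).1 hx
  have e : ψ x = ∑ g ∈ x.support, x g * ψ (Finsupp.single g 1) := by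
    conv_lhs => rw [← Finsupp.sum_single x, Finsupp.sum, map_sum]
    refine Finset.sum_congr rfl fun g _ => ?_
    rw [← smul_eq_mul, ← map_smul, Finsupp.smul_single, smul_eq_mul, mul_one]
  change φ' x = fineComponent k (a + p) (ψ x)
  rw [e, map_sum]
  refine (Finsupp.linearCombination_apply _ _).trans (Finset.sum_congr rfl fun g _ => ?_)
  have := fineComponent_mul (a := g.deg + p) (hx g) (ψ (Finsupp.single g 1))
  rw [← add_assoc, sub_add_cancel] at this
  exact this.symm

end GrMod

/-! ### Homogeneous Ext classes. -/

section HomogeneousExt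

variable {I : Ideal (MvPolynomial (Fin n) k)} {i : ℕ} {p : Fin n → ℤ}

lemma isHomogeneousExt_iff {e : ExtS (k := k) (n := n) i
    (ModuleCat.of (MvPolynomial (Fin n) k) (MvPolynomial (Fin n) k ⧸ I))} :
    IsHomogeneousExt I i p e ↔ ∃ (P : GradedResolution I) (f : _),
      P.IsHomogeneousHom i p f ∧ Represents P.res i f e := by
  constructor
  · rintro ⟨P, z, hz, he⟩
    exact ⟨P, _, hz, z, rfl, he⟩
  · rintro ⟨P, _, hf, z, rfl, he⟩
    exact ⟨P, z, hf, he⟩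

namespace GradedResolution

variable {P : GradedResolution I}

lemma IsHomogeneousHom.add {f g : P.res.complex.X i ⟶ polyModule k n}
    (hf : P.IsHomogeneousHom i p f) (hg : P.IsHomogeneousHom i p g) :
    P.IsHomogeneousHom i p (f + g) := fun a x hx => add_mem (hf a x hx) (hg a x hx)

lemma IsHomogeneousHom.smul {f : P.res.complex.X i ⟶ polyModule k n} {b : Fin n → ℤ}
    (hf : P.IsHomogeneousHom i p f) {s : MvPolynomial (Fin n) k} (hs : s ∈ fineDegree k b) :
    P.IsHomogeneousHom i (b + p) (s • f) := fun a x hx => by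
  rw [add_left_comm]
  exact mul_mem_fineDegree hs (hf a x hx)

lemma isHomogeneousHom_zero : P.IsHomogeneousHom i p 0 := fun _ _ _ => zero_mem _

lemma d_mem_part (P : GradedResolution I) (i l : ℕ) (a : Fin n → ℤ) (x : P.res.complex.X i)
    (hx : x ∈ P.part i a) : (P.res.complex.d i l).hom x ∈ P.part l a := by
  by_cases h : l + 1 = i
  · subst h
    exact P.d_mem l a x hx
  · rw [P.res.complex.shape i l h]
    exact zero_mem _

lemma hom_ext {f g : P.res.complex.X i ⟶ polyModule k n}
    (h : ∀ a, ∀ x ∈ P.part i a, f.hom x = g.hom x) : f = g := by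
  refine ModuleCat.hom_ext (LinearMap.ext fun x => ?_)
  have hx : x ∈ ⨆ a, P.part i a := P.iSup_part i ▸ AddSubgroup.mem_top x
  refine AddSubgroup.iSup_induction (P.part i) (C := fun x => f.hom x = g.hom x) hx h ?_ ?_
  · rw [map_zero, map_zero]
  · intro x y hx hy
    rw [map_add, map_add, hx, hy]

end GradedResolution

/-- The map `Ext^i(S / I', S) → Ext^i(S / I, S)` for `I ≤ I'`. -/
abbrev extMap {I I' : Ideal (MvPolynomial (Fin n) k)} (h : I ≤ I') (i : ℕ) :
    ExtS (k := k) (n := n) i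
      (ModuleCat.of (MvPolynomial (Fin n) k) (MvPolynomial (Fin n) k ⧸ I')) ⟶
    ExtS (k := k) (n := n) i
      (ModuleCat.of (MvPolynomial (Fin n) k) (MvPolynomial (Fin n) k ⧸ I)) :=
  ((Ext (MvPolynomial (Fin n) k) (ModuleCat.{u} (MvPolynomial (Fin n) k)) i).map
    (GrMod.IsTame.quotientMap h).op).app (polyModule k n)

lemma extMap_self (e : ExtS (k := k) (n := n) i
    (ModuleCat.of (MvPolynomial (Fin n) k) (MvPolynomial (Fin n) k ⧸ I))) :
    (extMap (le_refl I) i).hom e = e := by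
  have : GrMod.IsTame.quotientMap (le_refl I) = 𝟙 _ := by
    refine ModuleCat.hom_ext (LinearMap.ext fun x => ?_)
    obtain ⟨f, rfl⟩ := Ideal.Quotient.mk_surjective x
    rfl
  simp [extMap, this]

variable {j : Fin n} {c : ℕ}

/-- The definition of homogeneity allows any graded resolution. Pulling back along the comparison
map puts all representatives on one fixed resolution, where they can be added and divided. -/
lemma GrMod.IsTame.exists_represents_extMap {I' : Ideal (MvPolynomial (Fin n) k)}
    {hI : IsFineHomogeneous I} (hN : (GrMod.quotient hI).IsTame j c) (hc : 0 < c)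
    (hI' : IsFineHomogeneous I') (h : I ≤ I') {e : ExtS (k := k) (n := n) i
      (ModuleCat.of (MvPolynomial (Fin n) k) (MvPolynomial (Fin n) k ⧸ I'))}
    (he : IsHomogeneousExt I' i p e) :
    ∃ f, (hN.gradedResolution hc).IsHomogeneousHom i p f ∧
      Represents (hN.gradedResolution hc).res i f ((extMap h i).hom e) := by
  obtain ⟨P, f, hf, hfe⟩ := isHomogeneousExt_iff.1 he
  obtain ⟨φ, h1, h2⟩ := hN.exists_gradedChainMap hc P hI' h
  exact ⟨φ.f i ≫ f, fun a x hx => hf a _ (h1 i a x hx), hfe.map h2⟩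

lemma GrMod.IsTame.exists_represents {hI : IsFineHomogeneous I}
    (hN : (GrMod.quotient hI).IsTame j c) (hc : 0 < c) {e : ExtS (k := k) (n := n) i
      (ModuleCat.of (MvPolynomial (Fin n) k) (MvPolynomial (Fin n) k ⧸ I))}
    (he : IsHomogeneousExt I i p e) :
    ∃ f, (hN.gradedResolution hc).IsHomogeneousHom i p f ∧
      Represents (hN.gradedResolution hc).res i f e := by
  have := hN.exists_represents_extMap hc hI le_rfl he
  rwa [extMap_self] at this

/-- For `c = 1` tameness is vacuous. This supplies a graded free resolution for every homogeneous
ideal. -/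
lemma isTame_quotient_one (hI : IsFineHomogeneous I) (j : Fin n) :
    (GrMod.quotient hI).IsTame j 1 :=
  GrMod.isTame_quotient hI fun _ ha => (ha (by simp)).elim

lemma IsHomogeneousExt.extMap {I' : Ideal (MvPolynomial (Fin n) k)} (j : Fin n)
    (hI : IsFineHomogeneous I) (hI' : IsFineHomogeneous I') (h : I ≤ I')
    {e : ExtS (k := k) (n := n) i
      (ModuleCat.of (MvPolynomial (Fin n) k) (MvPolynomial (Fin n) k ⧸ I'))}
    (he : IsHomogeneousExt I' i p e) : IsHomogeneousExt I i p ((extMap h i).hom e) :=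
  isHomogeneousExt_iff.2 ⟨_,
    (isTame_quotient_one hI j).exists_represents_extMap one_pos hI' h he⟩

lemma IsHomogeneousExt.add (j : Fin n) (hI : IsFineHomogeneous I)
    {e e' : ExtS (k := k) (n := n) i
      (ModuleCat.of (MvPolynomial (Fin n) k) (MvPolynomial (Fin n) k ⧸ I))}
    (he : IsHomogeneousExt I i p e) (he' : IsHomogeneousExt I i p e') :
    IsHomogeneousExt I i p (e + e') := by
  obtain ⟨f, hf, hfe⟩ := (isTame_quotient_one hI j).exists_represents one_pos he
  obtain ⟨f', hf', hfe'⟩ := (isTame_quotient_one hI j).exists_represents one_pos he'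
  exact isHomogeneousExt_iff.2 ⟨_, _, hf.add hf', hfe.add hfe'⟩

lemma IsHomogeneousExt.smul {e : ExtS (k := k) (n := n) i
      (ModuleCat.of (MvPolynomial (Fin n) k) (MvPolynomial (Fin n) k ⧸ I))}
    (he : IsHomogeneousExt I i p e) {b : Fin n → ℤ} {s : MvPolynomial (Fin n) k}
    (hs : s ∈ fineDegree k b) : IsHomogeneousExt I i (b + p) (s • e) := by
  obtain ⟨P, f, hf, hfe⟩ := isHomogeneousExt_iff.1 he
  exact isHomogeneousExt_iff.2 ⟨P, _, hf.smul hs, hfe.smul s⟩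

lemma isHomogeneousExt_zero (j : Fin n) (hI : IsFineHomogeneous I) :
    IsHomogeneousExt I i p (0 : ExtS (k := k) (n := n) i
      (ModuleCat.of (MvPolynomial (Fin n) k) (MvPolynomial (Fin n) k ⧸ I))) :=
  isHomogeneousExt_iff.2 ⟨(isTame_quotient_one hI j).gradedResolution one_pos, 0,
    GradedResolution.isHomogeneousHom_zero, represents_zero⟩

lemma X_smul_hom_injective {M : ModuleCat.{u} (MvPolynomial (Fin n) k)} {f g : M ⟶ polyModule k n}
    (h : (X j : MvPolynomial (Fin n) k) • f = (X j : MvPolynomial (Fin n) k) • g) : f = g := by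
  refine ModuleCat.hom_ext (LinearMap.ext fun x => ?_)
  have : (X j : MvPolynomial (Fin n) k) * f.hom x = X j * g.hom x :=
    congrArg (fun φ => φ.hom x) h
  exact mul_left_cancel₀ (X_ne_zero j) this

/-! ### Multiplication by `x_j` on homogeneous Ext classes of a tame quotient. -/

section Step

variable {hI : IsFineHomogeneous I}

lemma GrMod.IsTame.exists_X_smul_hom_eq (hN : (GrMod.quotient hI).IsTame j c)
    (hc : 0 < c) (hp : ¬ (c : ℤ) ∣ p j + 1)
    {f : (hN.gradedResolution hc).res.complex.X i ⟶ polyModule k n}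
    (hf : (hN.gradedResolution hc).IsHomogeneousHom i (p + Pi.single j 1) f) :
    ∃ g, (hN.gradedResolution hc).IsHomogeneousHom i p g ∧
      (X j : MvPolynomial (Fin n) k) • g = f := by
  obtain ⟨φ, h1, h2⟩ := GrMod.exists_X_mul_cover_hom (N := (GrMod.quotient hI).tower j c i) hp
    f.hom hf
  refine ⟨ModuleCat.ofHom φ, h1, ?_⟩
  refine ModuleCat.hom_ext (LinearMap.ext fun x => ?_)
  exact h2 x

lemma GrMod.IsTame.exists_component_hom (hN : (GrMod.quotient hI).IsTame j c)
    (hc : 0 < c) (p : Fin n → ℤ)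
    (f : (hN.gradedResolution hc).res.complex.X i ⟶ polyModule k n) :
    ∃ g : (hN.gradedResolution hc).res.complex.X i ⟶ polyModule k n,
      ∀ a, ∀ x ∈ (hN.gradedResolution hc).part i a, g.hom x = fineComponent k (a + p) (f.hom x) := by
  obtain ⟨φ, h⟩ := GrMod.exists_component_cover_hom (N := (GrMod.quotient hI).tower j c i) p f.hom
  exact ⟨ModuleCat.ofHom φ, h⟩

/-- A representing cocycle is `x_j` times some cochain `g`, and `g` is a cocycle because `x_j` is a
nonzerodivisor on maps to `S`. -/
lemma GrMod.IsTame.exists_X_smul_ext_eq (hN : (GrMod.quotient hI).IsTame j c)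
    (hc : 0 < c) (hp : ¬ (c : ℤ) ∣ p j + 1)
    {e : ExtS (k := k) (n := n) i
      (ModuleCat.of (MvPolynomial (Fin n) k) (MvPolynomial (Fin n) k ⧸ I))}
    (he : IsHomogeneousExt I i (p + Pi.single j 1) e) :
    ∃ e', IsHomogeneousExt I i p e' ∧ (X j : MvPolynomial (Fin n) k) • e' = e := by
  obtain ⟨f, hf, hfe⟩ := hN.exists_represents hc he
  obtain ⟨g, hg, rfl⟩ := hN.exists_X_smul_hom_eq hc hp hf
  obtain ⟨e', he'⟩ := MonomialLC.exists_represents g (X_smul_hom_injective (j := j) (by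
    rw [← Linear.comp_smul, hfe.d_comp, smul_zero]))
  exact ⟨e', isHomogeneousExt_iff.2 ⟨_, g, hg, he'⟩, (he'.smul _).unique hfe⟩

/-- If `x_j f` is the coboundary of `v`, it is also that of the component of `v` of degree `p +
e_j`. This component is `x_j w`, and cancelling `x_j` exhibits `f` as the coboundary of `w`. -/
lemma GrMod.IsTame.ext_eq_zero_of_X_smul (hN : (GrMod.quotient hI).IsTame j c)
    (hc : 0 < c) (hp : ¬ (c : ℤ) ∣ p j + 1)
    {e : ExtS (k := k) (n := n) i
      (ModuleCat.of (MvPolynomial (Fin n) k) (MvPolynomial (Fin n) k ⧸ I))}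
    (he : IsHomogeneousExt I i p e) (h : (X j : MvPolynomial (Fin n) k) • e = 0) : e = 0 := by
  obtain ⟨f, hf, hfe⟩ := hN.exists_represents hc he
  obtain ⟨v, hv⟩ := (hfe.smul (X j)).eq_zero_iff.1 h
  obtain ⟨v', hv'⟩ := hN.exists_component_hom hc (p + Pi.single j 1) v
  obtain ⟨w, -, hw⟩ := hN.exists_X_smul_hom_eq hc hp (f := v') (fun a x hx => by
    rw [hv' a x hx]
    exact fineComponent_mem _ _)
  refine hfe.eq_zero_iff.2 ⟨w, X_smul_hom_injective (j := j) ?_⟩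
  rw [← Linear.comp_smul, hw]
  refine GradedResolution.hom_ext fun a x hx => ?_
  have h1 := hv' a _ ((hN.gradedResolution hc).d_mem_part i _ a x hx)
  have h2 : ((X j : MvPolynomial (Fin n) k) • f).hom x ∈
      fineDegree k (a + (p + Pi.single j 1)) := by
    rw [add_comm p]
    exact hf.smul (X_mem_fineDegree j) a x hx
  have h3 := congrArg (fun φ => φ.hom x) hv
  exact ((fineComponent_same h2).symm.trans (congrArg _ h3)).trans h1.symm

end Step

end HomogeneousExt

/-! ### Passage to the direct limit. -/

section Colimit

variable {B : Ideal (MvPolynomial (Fin n) k)} {i : ℕ}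

lemma toLC_extMap {t s : ℕ} (h : t ≤ s) (e : ExtS (k := k) (n := n) i
    (ModuleCat.of (MvPolynomial (Fin n) k) (MvPolynomial (Fin n) k ⧸ B ^ t))) :
    toLC B i s ((extMap (Ideal.pow_le_pow_right h) i).hom e) = toLC B i t e := by
  have := Limits.colimit.w (localCohomology.diagram (localCohomology.idealPowersDiagram B) i)
    (homOfLE h).op.op
  exact congrArg (fun φ => (φ.app (polyModule k n)).hom e) this

/-- Evaluation at `S` and the forgetful functor preserve this filtered colimit, so an element that
vanishes in the limit vanishes at a finite stage. -/
lemma exists_extMap_eq_zero {t : ℕ} {e : ExtS (k := k) (n := n) i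
    (ModuleCat.of (MvPolynomial (Fin n) k) (MvPolynomial (Fin n) k ⧸ B ^ t))}
    (he : toLC B i t e = 0) :
    ∃ (s : ℕ) (h : t ≤ s), (extMap (Ideal.pow_le_pow_right h : B ^ s ≤ B ^ t) i).hom e = 0 := by
  let F := localCohomology.diagram (localCohomology.idealPowersDiagram B) i
  let ev := (evaluation (ModuleCat.{u} (MvPolynomial (Fin n) k))
    (ModuleCat.{u} (MvPolynomial (Fin n) k))).obj (polyModule k n)
  have : Limits.PreservesFilteredColimitsOfSize.{0, 0}
      (forget (ModuleCat.{u} (MvPolynomial (Fin n) k))) :=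
    Limits.preservesFilteredColimitsOfSize_shrink.{0, u, 0, u} _
  obtain ⟨s, f, g, hfg⟩ := Limits.Concrete.isColimit_exists_of_rep_eq (F ⋙ ev)
    (Limits.isColimitOfPreserves ev (Limits.colimit.isColimit F))
    (i := Opposite.op (Opposite.op t)) (j := Opposite.op (Opposite.op t)) e 0
    (he.trans (map_zero _).symm)
  exact ⟨s.unop.unop, leOfHom f.unop.unop, hfg.trans (map_zero _)⟩

end Colimit

lemma extMap_extMap {I J K : Ideal (MvPolynomial (Fin n) k)} (h : I ≤ J) (h' : J ≤ K) (i : ℕ)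
    (e : ExtS (k := k) (n := n) i
      (ModuleCat.of (MvPolynomial (Fin n) k) (MvPolynomial (Fin n) k ⧸ K))) :
    (extMap h i).hom ((extMap h' i).hom e) = (extMap (h.trans h') i).hom e := by
  have : GrMod.IsTame.quotientMap (h.trans h') =
      GrMod.IsTame.quotientMap h ≫ GrMod.IsTame.quotientMap h' := by
    refine ModuleCat.hom_ext (LinearMap.ext fun x => ?_)
    obtain ⟨f, rfl⟩ := Ideal.Quotient.mk_surjective x
    rfl
  simp [extMap, this]

/-! ### Multiplication by monomials on the components of local cohomology. -/

section DegreePart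

variable {B : Ideal (MvPolynomial (Fin n) k)} {i : ℕ} {p : Fin n → ℤ}

lemma monomial_smul_mem_degreePart (p q : Fin n → ℤ) (a : Fin n →₀ ℕ)
    (hq : ∀ j, q j = p j + (a j : ℤ)) {x : LC B i} (hx : x ∈ degreePart B i p) :
    monomial a (1 : k) • x ∈ degreePart B i q := by
  have hq' : (fun j => (a j : ℤ)) + p = q := funext fun j => by
    rw [hq, Pi.add_apply, add_comm]
  induction hx using Submodule.span_induction with
  | mem x hx =>
    obtain ⟨t, e, he, rfl⟩ := hx
    refine Submodule.subset_span ⟨t, monomial a (1 : k) • e, ?_, map_smul _ _ _⟩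
    exact hq' ▸ he.smul (monomial_mem_fineDegree a 1)
  | zero => rw [smul_zero]; exact zero_mem _
  | add x y _ _ hx hy => rw [smul_add]; exact add_mem hx hy
  | smul r x _ hx => rw [smul_comm]; exact Submodule.smul_mem _ r hx

/-- Two homogeneous classes can be moved to a common stage and added there, so the span in
`degreePart` contains nothing new. -/
lemma exists_of_mem_degreePart (j : Fin n) (hB : IsFineHomogeneous B) {x : LC B i}
    (hx : x ∈ degreePart B i p) : ∃ t e, IsHomogeneousExt (B ^ t) i p e ∧ toLC B i t e = x := by
  induction hx using Submodule.span_induction with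
  | mem x hx => exact hx
  | zero => exact ⟨0, 0, isHomogeneousExt_zero j (hB.pow 0), map_zero _⟩
  | add x y _ _ hx hy =>
    obtain ⟨t, e, he, rfl⟩ := hx
    obtain ⟨s, e', he', rfl⟩ := hy
    refine ⟨max t s, _, (he.extMap j (hB.pow (max t s)) (hB.pow t)
      (Ideal.pow_le_pow_right (le_max_left t s))).add j (hB.pow _)
      (he'.extMap j (hB.pow (max t s)) (hB.pow s) (Ideal.pow_le_pow_right (le_max_right t s))), ?_⟩
    rw [map_add, toLC_extMap (le_max_left t s), toLC_extMap (le_max_right t s)]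
  | smul r x _ hx =>
    obtain ⟨t, e, he, rfl⟩ := hx
    refine ⟨t, (C r : MvPolynomial (Fin n) k) • e, ?_, map_smul _ _ _⟩
    have := he.smul (s := C r) (b := 0) (isWeightedHomogeneous_C _ _)
    rwa [zero_add] at this

/-- A nonzero integer `m + 1` has a positive non-divisor `c`. -/
lemma exists_pos_not_dvd {m : ℤ} (hm : m + 1 ≠ 0) : ∃ c : ℕ, 0 < c ∧ ¬ (c : ℤ) ∣ m + 1 := by
  -- The witness exceeds `|m + 1|`, which is positive, so it cannot divide `m + 1`.
  refine ⟨(m + 1).natAbs + 1, Nat.succ_pos _, fun h => ?_⟩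
  have := Int.natAbs_dvd_natAbs.2 h
  rw [Int.natAbs_natCast] at this
  exact absurd (Nat.le_of_dvd (Int.natAbs_pos.2 hm) this) (by omega)

variable {A : Set (Finset (Fin n))} {j : Fin n}

lemma isTame_quotient_powIdeal (A : Set (Finset (Fin n))) (j : Fin n) {c m : ℕ} (h : c ∣ m) :
    (GrMod.quotient (isFineHomogeneous_powIdeal (k := k) A m)).IsTame j c :=
  GrMod.isTame_quotient _ fun _ ha _ hf => mem_powIdeal_of_X_mul_mem A h ha hf

lemma exists_X_smul_eq (hp : p j ≠ -1) {y : LC (powIdeal k A 1) i}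
    (hy : y ∈ degreePart (powIdeal k A 1) i (p + Pi.single j 1)) :
    ∃ x ∈ degreePart (powIdeal k A 1) i p, (X j : MvPolynomial (Fin n) k) • x = y := by
  obtain ⟨c, hc, hcp⟩ := exists_pos_not_dvd (m := p j) (by omega)
  have hB := isFineHomogeneous_powIdeal (k := k) A 1
  obtain ⟨t, e, he, rfl⟩ := exists_of_mem_degreePart j hB hy
  have hN := isTame_quotient_powIdeal (k := k) A j (dvd_mul_right c t)
  have hJ := isFineHomogeneous_powIdeal (k := k) A (c * t)
  have h1 := powIdeal_le_pow (k := k) A (c * t) t (Nat.le_mul_of_pos_left t hc)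
  obtain ⟨N, hN'⟩ := exists_pow_le_powIdeal (k := k) A (c * t)
  -- The class moves along `B^(max N t) ≤ B^[c t] ≤ B^t`: it is divided by `x_j` at the middle
  -- ideal, and the quotient is carried to a genuine power of `B`. The maximum with `t` lets
  -- `toLC_extMap` compare the two ends.
  have h2 : powIdeal k A 1 ^ (max N t) ≤ powIdeal k A (c * t) :=
    (Ideal.pow_le_pow_right (le_max_left N t)).trans hN'
  obtain ⟨e', he', hee'⟩ := hN.exists_X_smul_ext_eq hc hcp (he.extMap j hJ (hB.pow t) h1)
  refine ⟨_, Submodule.subset_span ⟨max N t, _, he'.extMap j (hB.pow _) hJ h2, rfl⟩, ?_⟩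
  rw [← map_smul, ← map_smul, hee', extMap_extMap, toLC_extMap (le_max_right N t)]

/-- The product with `x_j` already vanishes at a finite stage `t`. Over `B^[c t]` the multiplication
is injective in degree `p`, so the class vanishes there and hence in the limit. -/
lemma eq_zero_of_X_smul_eq_zero (hp : p j ≠ -1) {x : LC (powIdeal k A 1) i}
    (hx : x ∈ degreePart (powIdeal k A 1) i p)
    (h : (X j : MvPolynomial (Fin n) k) • x = 0) : x = 0 := by
  obtain ⟨c, hc, hcp⟩ := exists_pos_not_dvd (m := p j) (by omega)
  have hB := isFineHomogeneous_powIdeal (k := k) A 1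
  obtain ⟨t₀, e₀, he₀, rfl⟩ := exists_of_mem_degreePart j hB hx
  rw [← map_smul] at h
  obtain ⟨t, ht, h0⟩ := exists_extMap_eq_zero h
  rw [← toLC_extMap ht]
  have he := he₀.extMap j (hB.pow t) (hB.pow t₀) (Ideal.pow_le_pow_right ht)
  rw [map_smul] at h0
  generalize (extMap (Ideal.pow_le_pow_right ht) i).hom e₀ = e at *
  have hN := isTame_quotient_powIdeal (k := k) A j (dvd_mul_right c t)
  have hJ := isFineHomogeneous_powIdeal (k := k) A (c * t)
  have h1 := powIdeal_le_pow (k := k) A (c * t) t (Nat.le_mul_of_pos_left t hc)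
  obtain ⟨N, hN'⟩ := exists_pow_le_powIdeal (k := k) A (c * t)
  have h2 : powIdeal k A 1 ^ (max N t) ≤ powIdeal k A (c * t) :=
    (Ideal.pow_le_pow_right (le_max_left N t)).trans hN'
  have h3 := hN.ext_eq_zero_of_X_smul hc hcp (he.extMap j hJ (hB.pow t) h1)
    (by rw [← map_smul, h0, map_zero])
  rw [← toLC_extMap (le_max_right N t), ← extMap_extMap h2 h1, h3, map_zero, map_zero]

lemma neg_congr_of_le {p r q : Fin n → ℤ} (h : neg p = neg q) (hpr : ∀ j, p j ≤ r j)
    (hrq : ∀ j, r j ≤ q j) : neg p = neg r ∧ neg r = neg q := by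
  have key : neg p = neg r := by
    refine Set.Subset.antisymm (fun j hj => ?_) fun j hj => lt_of_le_of_lt (hpr j) hj
    rw [h] at hj
    exact lt_of_le_of_lt (hrq j) hj
  exact ⟨key, key.symm.trans h⟩

/-- Multiplication by a monomial that does not change the sign pattern of the degree is
bijective. -/
lemma monomial_smul_bijective (a : Fin n →₀ ℕ) (p q : Fin n → ℤ) (hpq : neg p = neg q)
    (hq : ∀ j, q j = p j + (a j : ℤ)) :
    (∀ x ∈ degreePart (powIdeal k A 1) i p, monomial a (1 : k) • x = 0 → x = 0) ∧
    ∀ y ∈ degreePart (powIdeal k A 1) i q, ∃ x ∈ degreePart (powIdeal k A 1) i p,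
      monomial a (1 : k) • x = y := by
  let Bij : (Fin n →₀ ℕ) → Prop := fun a => ∀ p q : Fin n → ℤ, neg p = neg q →
    (∀ j, q j = p j + (a j : ℤ)) →
    (∀ x ∈ degreePart (powIdeal k A 1) i p, monomial a (1 : k) • x = 0 → x = 0) ∧
    ∀ y ∈ degreePart (powIdeal k A 1) i q, ∃ x ∈ degreePart (powIdeal k A 1) i p,
      monomial a (1 : k) • x = y
  suffices h : Bij a from h p q hpq hq
  have zero : Bij 0 := by
    intro p q _ hq
    obtain rfl : q = p := funext fun j => by simpa using hq j
    have h1 : monomial (0 : Fin n →₀ ℕ) (1 : k) = 1 := rfl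
    simp only [h1, one_smul]
    exact ⟨fun _ _ h => h, fun y hy => ⟨y, hy, rfl⟩⟩
  have add : ∀ a b, Bij a → Bij b → Bij (a + b) := by
    intro a b ha hb p q hpq hq
    have hq' : ∀ j, q j = p j + a j + b j := fun j => by
      rw [hq, Finsupp.add_apply]; push_cast; ring
    -- The intermediate degree lies between `p` and `q`, so it has their sign pattern.
    obtain ⟨h1, h2⟩ := neg_congr_of_le (r := fun j => p j + a j) hpq
      (fun j => by simp) (fun j => by simp [hq' j])
    obtain ⟨ha1, ha2⟩ := ha p _ h1 fun _ => rfl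
    obtain ⟨hb1, hb2⟩ := hb _ q h2 hq'
    have hab : ∀ x : LC (powIdeal k A 1) i, monomial (a + b) (1 : k) • x =
        monomial b (1 : k) • monomial a (1 : k) • x := fun x => by
      rw [smul_smul, monomial_mul, one_mul, add_comm]
    refine ⟨fun x hx h => ?_, fun y hy => ?_⟩
    · rw [hab] at h
      exact ha1 x hx (hb1 _ (monomial_smul_mem_degreePart p _ a (fun _ => rfl) hx) h)
    · obtain ⟨z, hz, rfl⟩ := hb2 y hy
      obtain ⟨x, hx, rfl⟩ := ha2 z hz
      exact ⟨x, hx, hab x⟩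
  have one : ∀ j, Bij (Finsupp.single j 1) := by
    intro j p q hpq hq
    obtain rfl : q = p + Pi.single j 1 := funext fun l => by
      rw [hq, Pi.add_apply, Finsupp.single_apply, Pi.single_apply]
      simp [eq_comm]
    -- If `p j = -1`, adding `e_j` would remove `j` from the set of negative coordinates.
    have hp : p j ≠ -1 := by
      intro hp
      have h1 : j ∈ neg p := by simp [neg, hp]
      rw [hpq] at h1
      simp [neg, hp] at h1
    exact ⟨fun x hx h => eq_zero_of_X_smul_eq_zero hp hx h, fun y hy => exists_X_smul_eq hp hy⟩
  clear hq
  induction a using Finsupp.induction_linear with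
  | zero => exact zero
  | add a b ha hb => exact add a b ha hb
  | single j m =>
    induction m with
    | zero => rw [Finsupp.single_zero]; exact zero
    | succ m ih => rw [Finsupp.single_add]; exact add _ _ ih (one j)

end DegreePart

/-! ### The canonical isomorphisms. -/

/-- The exponent vector of the monomial `x^{m - p}`, for `p ≤ m`. -/
def diffExp (p m : Fin n → ℤ) : Fin n →₀ ℕ :=
  Finsupp.equivFunOnFinite.symm fun j => (m j - p j).toNat

lemma eq_add_diffExp {p m : Fin n → ℤ} (h : p ≤ m) (j : Fin n) :
    m j = p j + (diffExp p m j : ℤ) := by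
  have : p j ≤ m j := h j
  simp only [diffExp, Finsupp.equivFunOnFinite_symm_apply_apply]
  omega

lemma diffExp_eq {p m : Fin n → ℤ} {a : Fin n →₀ ℕ} (h : ∀ j, m j = p j + (a j : ℤ)) :
    diffExp p m = a := by
  ext j
  simp [diffExp, h j]

lemma diffExp_add {p m m' : Fin n → ℤ} (h : p ≤ m) (h' : m ≤ m') :
    diffExp p m' = diffExp m m' + diffExp p m :=
  diffExp_eq fun j => by
    rw [eq_add_diffExp h' j, eq_add_diffExp h j, Finsupp.add_apply]
    push_cast
    ring

lemma neg_sup {p q : Fin n → ℤ} (h : neg p = neg q) : neg p = neg (p ⊔ q) := by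
  ext j
  have := Set.ext_iff.1 h j
  simp only [neg, Set.mem_ofPred_eq, Pi.sup_apply, sup_lt_iff] at this ⊢
  tauto

variable (A : Set (Finset (Fin n))) (i : ℕ)

/-- Multiplication by `x^{m - p}` from the component of degree `p` to that of degree `m`. -/
def mulMap (p m : Fin n → ℤ) (hle : p ≤ m) :
    degreePart (powIdeal k A 1) i p →ₗ[k] degreePart (powIdeal k A 1) i m where
  toFun x := ⟨monomial (diffExp p m) (1 : k) • (x : LC (powIdeal k A 1) i),
    monomial_smul_mem_degreePart p m _ (eq_add_diffExp hle) x.2⟩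
  map_add' _ _ := Subtype.ext (smul_add _ _ _)
  map_smul' r x := Subtype.ext (smul_comm _ r (x : LC (powIdeal k A 1) i))

lemma mulMap_bijective (p m : Fin n → ℤ) (h : neg p = neg m) (hle : p ≤ m) :
    Function.Bijective (mulMap (k := k) A i p m hle) := by
  obtain ⟨h1, h2⟩ := monomial_smul_bijective (A := A) (i := i) (k := k) _ p m h
    (eq_add_diffExp hle)
  constructor
  · rw [← LinearMap.ker_eq_bot, LinearMap.ker_eq_bot']
    exact fun x hx => Subtype.ext (h1 x x.2 (congrArg Subtype.val hx))
  · rintro ⟨y, hy⟩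
    obtain ⟨x, hx, rfl⟩ := h2 y hy
    exact ⟨⟨x, hx⟩, rfl⟩

/-- Multiplication by `x^{m - p}` on homogeneous components with the same sign pattern. -/
def mulEquiv (p m : Fin n → ℤ) (h : neg p = neg m) (hle : p ≤ m) :
    degreePart (powIdeal k A 1) i p ≃ₗ[k] degreePart (powIdeal k A 1) i m :=
  LinearEquiv.ofBijective (mulMap A i p m hle) (mulMap_bijective A i p m h hle)

lemma coe_mulEquiv (p m : Fin n → ℤ) (h : neg p = neg m) (hle : p ≤ m)
    (x : degreePart (powIdeal k A 1) i p) :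
    (mulEquiv A i p m h hle x : LC (powIdeal k A 1) i) =
      monomial (diffExp p m) (1 : k) • (x : LC (powIdeal k A 1) i) := rfl

/-- The canonical isomorphism between components with the same sign pattern. -/
def signEquiv (p q : Fin n → ℤ) (h : neg p = neg q) :
    degreePart (powIdeal k A 1) i p ≃ₗ[k] degreePart (powIdeal k A 1) i q :=
  (mulEquiv A i p (p ⊔ q) (neg_sup h) le_sup_left).trans
    (mulEquiv A i q (p ⊔ q) (h.symm.trans (neg_sup h)) le_sup_right).symm

/-- Allowing any common upper bound `m`, and not only `p ⊔ q`, makes it possible to compare three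
degrees at once. -/
lemma signEquiv_spec (p q m : Fin n → ℤ) (h : neg p = neg q) (hp : p ≤ m) (hq : q ≤ m)
    (x : degreePart (powIdeal k A 1) i p) :
    monomial (diffExp q m) (1 : k) • (signEquiv A i p q h x : LC (powIdeal k A 1) i) =
      monomial (diffExp p m) (1 : k) • (x : LC (powIdeal k A 1) i) := by
  have h0 : monomial (diffExp q (p ⊔ q)) (1 : k) •
      (signEquiv A i p q h x : LC (powIdeal k A 1) i) =
      monomial (diffExp p (p ⊔ q)) (1 : k) • (x : LC (powIdeal k A 1) i) := by
    rw [← coe_mulEquiv A i q (p ⊔ q) (h.symm.trans (neg_sup h)) le_sup_right,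
      ← coe_mulEquiv A i p (p ⊔ q) (neg_sup h) le_sup_left, signEquiv, LinearEquiv.trans_apply,
      LinearEquiv.apply_symm_apply]
  have key : ∀ r (_ : r ≤ p ⊔ q) (y : LC (powIdeal k A 1) i),
      monomial (diffExp r m) (1 : k) • y =
      monomial (diffExp (p ⊔ q) m) (1 : k) • monomial (diffExp r (p ⊔ q)) (1 : k) • y := by
    intro r hr y
    rw [smul_smul, monomial_mul, one_mul, ← diffExp_add hr (sup_le hp hq)]
  rw [key q le_sup_right, key p le_sup_left, h0]

end MonomialLC

end

/-- The spaces `H^i_B(S)_p` with a given set `neg p` are canonically isomorphic: there is exactly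
one family of `k`-linear isomorphisms `φ_{p,q} : H^i_B(S)_p ≃ H^i_B(S)_q`, for `neg p = neg q`,
that is transitive and is multiplication by `x^a` whenever `q = p + a` with `a ∈ ℕⁿ`. -/
theorem theorem1p1 {k : Type u} [Field k] {n : ℕ} (B : Ideal (MvPolynomial (Fin n) k))
    (hB : MonomialLC.IsSquarefreeMonomialIdeal B) (i : ℕ) :
    ∃! φ : ∀ p q : Fin n → ℤ, MonomialLC.neg p = MonomialLC.neg q →
        (MonomialLC.degreePart B i p ≃ₗ[k] MonomialLC.degreePart B i q),
      (∀ (p q r : Fin n → ℤ) (hpq : MonomialLC.neg p = MonomialLC.neg q)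
        (hqr : MonomialLC.neg q = MonomialLC.neg r) (x : MonomialLC.degreePart B i p),
        φ q r hqr (φ p q hpq x) = φ p r (hpq.trans hqr) x) ∧
      (∀ (p q : Fin n → ℤ) (hpq : MonomialLC.neg p = MonomialLC.neg q) (a : Fin n →₀ ℕ),
        (∀ j, q j = p j + (a j : ℤ)) → ∀ x : MonomialLC.degreePart B i p,
        (φ p q hpq x : MonomialLC.LC B i) =
          (MvPolynomial.monomial a (1 : k)) • (x : MonomialLC.LC B i)) := by
  obtain ⟨A, rfl⟩ := hB.exists_eq_powIdeal
  refine ⟨fun p q h => MonomialLC.signEquiv A i p q h, ⟨?_, ?_⟩, ?_⟩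
  · intro p q r hpq hqr x
    let m := p ⊔ q ⊔ r
    have hp : p ≤ m := le_sup_left.trans le_sup_left
    have hq : q ≤ m := le_sup_right.trans le_sup_left
    have hr : r ≤ m := le_sup_right
    have hrm : MonomialLC.neg r = MonomialLC.neg m :=
      (hpq.trans hqr).symm.trans ((MonomialLC.neg_sup hpq).trans (MonomialLC.neg_sup
        ((MonomialLC.neg_sup hpq).symm.trans (hpq.trans hqr))))
    -- Both sides may be compared after the injective multiplication into degree `m`, where each
    -- becomes `x^{m - p} x`.
    refine (MonomialLC.mulEquiv A i r m hrm hr).injective (Subtype.ext ?_)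
    rw [MonomialLC.coe_mulEquiv, MonomialLC.coe_mulEquiv, MonomialLC.signEquiv_spec A i q r m hqr hq
      hr, MonomialLC.signEquiv_spec A i p q m hpq hp hq,
      MonomialLC.signEquiv_spec A i p r m (hpq.trans hqr) hp hr]
  · intro p q hpq a ha x
    have hle : p ≤ q := fun j => (ha j).symm ▸ le_add_of_nonneg_right (Int.natCast_nonneg _)
    -- With `q` itself as upper bound, the monomial on the left is `1`.
    have h := MonomialLC.signEquiv_spec A i p q q hpq hle le_rfl x
    rw [MonomialLC.diffExp_eq ha, MonomialLC.diffExp_eq (a := 0) (by simp)] at h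
    exact (one_smul _ _).symm.trans h
  · rintro ψ ⟨h1, h2⟩
    funext p q hpq
    ext1 x
    have hqm := hpq.symm.trans (MonomialLC.neg_sup hpq)
    -- Multiplication into degree `p ⊔ q` is `ψ q (p ⊔ q)`, so transitivity turns the left side into
    -- `ψ p (p ⊔ q) x`, again a multiplication by a monomial.
    refine (MonomialLC.mulEquiv A i q (p ⊔ q) hqm le_sup_right).injective (Subtype.ext ?_)
    rw [MonomialLC.coe_mulEquiv, MonomialLC.coe_mulEquiv,
      MonomialLC.signEquiv_spec A i p q _ hpq le_sup_left le_sup_right,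
      ← h2 q (p ⊔ q) hqm _ (MonomialLC.eq_add_diffExp le_sup_right), h1,
      h2 p (p ⊔ q) _ _ (MonomialLC.eq_add_diffExp le_sup_left)]
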